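/- Let $M$ and $M'$ be compact, connected, smooth Riemannian manifolds without boundary, of the same dimension $d\ge 1$. Let $dx$ be the Riemannian volume, $\mathbf L^2(M)$ the space of complex-valued square integrable functions on $M$, and $\Delta$ the Laplace-Beltrami operator. Let $(\varphi_k)_{k\ge 0}$ be any orthonormal basis of $\mathbf L^2(M)$ consisting of (possibly complex-valued, smooth) eigenfunctions, $-\Delta\varphi_k=\lambda_k\varphi_k$, where $\lambda_0\le\lambda_1\le\lambda_2\le\cdots$. For $f\in\mathbf L^2(M)$ put $\widehat f(k)=\int_M f\,\overline{\varphi_k}\,dx$. For $h\in\mathbf L^2(M)$ let $$T_h f=\sum_{k\ge 0}\widehat f(k)\,\widehat h(k)\,\varphi_k ,\qquad f\in\mathbf L^2(M).$$ Call $h$ a spectral filter if $\lambda_k=\lambda_\ell$ implies $\widehat h(k)=\widehat h(\ell)$; then there is a function $H$, with complex values, such that $H(\lambda_k)=\widehat h(k)$ for all $k$. An isometry $\zeta:M\to M'$ is a smooth diffeomorphism whose differential preserves the Riemannian inner products; it defines the operator $V_\zeta:\mathbf L^2(M)\to\mathbf L^2(M')$, $V_\zeta f=f\circ\zeta^{-1}$.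 Theorem. Let $h\in\mathbf L^2(M)$ be a spectral filter. (1) For every isometry $\zeta:M\to M$ and every $f\in\mathbf L^2(M)$, $T_hV_\zeta f=V_\zeta T_hf$. (2) Let $H$ be any function with $H(\lambda_k)=\widehat h(k)$ for all $k$, and let $(\varphi'_k)_{k\ge 0}$ be any orthonormal basis of $\mathbf L^2(M')$ consisting of eigenfunctions, $-\Delta'\varphi'_k=\lambda'_k\varphi'_k$ with $\lambda'_0\le\lambda'_1\le\cdots$. If $\zeta:M\to M'$ is an isometry, then the series $$K'_h(x,y)=\sum_{k\ge 0}H(\lambda'_k)\,\varphi'_k(x)\,\overline{\varphi'_k(y)}$$ converges in $\mathbf L^2(M'\times M')$, integration against $K'_h$ defines a bounded operator $T'_h$ on $\mathbf L^2(M')$, and $$T'_hV_\zeta f=V_\zeta T_hf\qquad\text{for every } f\in\mathbf L^2(M).$$ -/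

import Mathlib

open MeasureTheory Filter Bundle
open scoped Manifold ContDiff Topology

noncomputable section

section Geometry

variable {d : ℕ} {M : Type*} [TopologicalSpace M] [ChartedSpace (EuclideanSpace ℝ (Fin d)) M]

/-- The coordinate vector field `∂ᵢ` of the chart `e`, at the point with coordinates `y`. -/
def coordField (e : OpenPartialHomeomorph M (EuclideanSpace ℝ (Fin d))) (i : Fin d)
    (y : EuclideanSpace ℝ (Fin d)) : TangentSpace (𝓡 d) (e.symm y) :=
  mfderiv (𝓡 d) (𝓡 d) e.symm y (EuclideanSpace.single i (1 : ℝ) : EuclideanSpace ℝ (Fin d))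

/-- The partial derivative `∂ᵢ F` of a function of `d` real variables. -/
def partialDeriv (i : Fin d) (F : EuclideanSpace ℝ (Fin d) → ℂ)
    (y : EuclideanSpace ℝ (Fin d)) : ℂ :=
  fderiv ℝ F y (EuclideanSpace.single i (1 : ℝ))

variable [RiemannianBundle (fun x : M => TangentSpace (𝓡 d) x)]

/-- The matrix `g_{ij} = ⟨∂ᵢ, ∂ⱼ⟩` of the Riemannian metric in the chart `e`. -/
def gram (e : OpenPartialHomeomorph M (EuclideanSpace ℝ (Fin d)))
    (y : EuclideanSpace ℝ (Fin d)) : Matrix (Fin d) (Fin d) ℝ :=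
  Matrix.of fun i j => inner ℝ (coordField e i y) (coordField e j y)

/-- The volume density `√(det g)` of the Riemannian metric in the chart `e`. -/
def volDensity (e : OpenPartialHomeomorph M (EuclideanSpace ℝ (Fin d)))
    (y : EuclideanSpace ℝ (Fin d)) : ℝ :=
  Real.sqrt (gram e y).det

/-- The Laplace-Beltrami operator in the chart `e`:
`Δ u = (√det g)⁻¹ ∑ᵢ ∂ᵢ (√det g ∑ⱼ g^{ij} ∂ⱼ u)`, at the point with coordinates `y`. -/
def chartLaplacian (e : OpenPartialHomeomorph M (EuclideanSpace ℝ (Fin d)))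
    (u : M → ℂ) (y : EuclideanSpace ℝ (Fin d)) : ℂ :=
  (((volDensity e y)⁻¹ : ℝ) : ℂ) * ∑ i : Fin d, partialDeriv i (fun z =>
    (volDensity e z : ℂ) * ∑ j : Fin d,
      (((gram e z)⁻¹ i j : ℝ) : ℂ) * partialDeriv j (u ∘ e.symm) z) y

/-- `-Δ u = lam u`, for a smooth function `u` on the manifold. The equation is required in every
smooth chart. -/
def IsLaplaceEigenfunction (lam : ℝ) (u : M → ℂ) : Prop :=
  ContMDiff (𝓡 d) 𝓘(ℝ, ℂ) ∞ u ∧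
    ∀ e ∈ IsManifold.maximalAtlas (𝓡 d) ∞ M, ∀ x ∈ e.source,
      -chartLaplacian e u (e x) = (lam : ℂ) * u x

variable [MeasurableSpace M]

/-- The Riemannian volume on the domain of the chart `e`, that is the measure
`√(det g) dy¹ ⋯ dyᵈ` on the image of the chart, transported to the manifold. -/
def chartVolume (e : OpenPartialHomeomorph M (EuclideanSpace ℝ (Fin d))) : Measure M :=
  ((volume.restrict e.target).withDensity
    (fun y => ENNReal.ofReal (volDensity e y))).map e.symm

variable (d M) in
/-- The Riemannian volume. The measures `chartVolume e` agree on the overlaps of the charts, so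
that their supremum is the measure which restricts to `chartVolume e` on the domain of each smooth
chart `e`. -/
def riemannianVolume : Measure M :=
  ⨆ e ∈ IsManifold.maximalAtlas (𝓡 d) ∞ M, chartVolume e

end Geometry

section Isometry

variable {d : ℕ}
  {M : Type*} [TopologicalSpace M] [ChartedSpace (EuclideanSpace ℝ (Fin d)) M]
  {M' : Type*} [TopologicalSpace M'] [ChartedSpace (EuclideanSpace ℝ (Fin d)) M']

/-- The chart `e ∘ ζ⁻¹` of `M'`, for a chart `e` of `M` and a diffeomorphism `ζ : M → M'`. -/
def transportChart (ζ : M ≃ₘ^∞⟮𝓡 d, 𝓡 d⟯ M')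
    (e : OpenPartialHomeomorph M (EuclideanSpace ℝ (Fin d))) :
    OpenPartialHomeomorph M' (EuclideanSpace ℝ (Fin d)) :=
  ζ.symm.toHomeomorph.transOpenPartialHomeomorph e

theorem transportChart_mem [IsManifold (𝓡 d) ∞ M] [IsManifold (𝓡 d) ∞ M']
    (ζ : M ≃ₘ^∞⟮𝓡 d, 𝓡 d⟯ M') {e : OpenPartialHomeomorph M (EuclideanSpace ℝ (Fin d))}
    (he : e ∈ IsManifold.maximalAtlas (𝓡 d) ∞ M) :
    transportChart ζ e ∈ IsManifold.maximalAtlas (𝓡 d) ∞ M' := by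
  rw [IsManifold.mem_maximalAtlas_iff_contMDiffOn] at he ⊢
  refine ⟨?_, ?_⟩
  · exact he.1.comp ζ.symm.contMDiff.contMDiffOn (fun x hx => hx)
  · exact ζ.contMDiff.comp_contMDiffOn he.2

theorem transportChart_symm_transportChart (ζ : M ≃ₘ^∞⟮𝓡 d, 𝓡 d⟯ M')
    (e : OpenPartialHomeomorph M' (EuclideanSpace ℝ (Fin d))) :
    transportChart ζ (transportChart ζ.symm e) = e := by
  refine OpenPartialHomeomorph.ext _ _ (fun x => ?_) (fun y => ?_) ?_
  · exact congrArg e (ζ.apply_symm_apply x)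
  · exact ζ.apply_symm_apply _
  · ext x
    change ζ (ζ.symm x) ∈ e.source ↔ _
    rw [ζ.apply_symm_apply]

variable [RiemannianBundle (fun x : M => TangentSpace (𝓡 d) x)]
  [RiemannianBundle (fun x : M' => TangentSpace (𝓡 d) x)]

/-- A diffeomorphism is an isometry of Riemannian manifolds if its differential preserves the
inner products of tangent vectors. -/
def IsRiemannianIsometry (ζ : M ≃ₘ^∞⟮𝓡 d, 𝓡 d⟯ M') : Prop :=
  ∀ (x : M) (v w : TangentSpace (𝓡 d) x),
    inner ℝ (mfderiv (𝓡 d) (𝓡 d) ζ x v) (mfderiv (𝓡 d) (𝓡 d) ζ x w) = inner ℝ v w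

theorem gram_transportChart [IsManifold (𝓡 d) ∞ M] {ζ : M ≃ₘ^∞⟮𝓡 d, 𝓡 d⟯ M'}
    (hζ : IsRiemannianIsometry ζ) {e : OpenPartialHomeomorph M (EuclideanSpace ℝ (Fin d))}
    (he : e ∈ IsManifold.maximalAtlas (𝓡 d) ∞ M) {y : EuclideanSpace ℝ (Fin d)}
    (hy : y ∈ e.target) : gram (transportChart ζ e) y = gram e y := by
  have h1 : MDifferentiableAt (𝓡 d) (𝓡 d) ζ (e.symm y) :=
    ζ.contMDiff.mdifferentiable (by simp) _
  have h2 : MDifferentiableAt (𝓡 d) (𝓡 d) e.symm y :=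
    (contMDiffAt_symm_of_mem_maximalAtlas he hy).mdifferentiableAt (by simp)
  have h3 : mfderiv (𝓡 d) (𝓡 d) (transportChart ζ e).symm y =
      (mfderiv (𝓡 d) (𝓡 d) ζ (e.symm y)).comp (mfderiv (𝓡 d) (𝓡 d) e.symm y) :=
    mfderiv_comp y h1 h2
  ext i j
  have h4 : ∀ i, coordField (transportChart ζ e) i y =
      mfderiv (𝓡 d) (𝓡 d) ζ (e.symm y) (coordField e i y) := fun i => by
    unfold coordField
    rw [h3]
    rfl
  change inner ℝ (coordField (transportChart ζ e) i y) (coordField (transportChart ζ e) j y) = _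
  rw [h4, h4]
  exact hζ _ _ _

variable [MeasurableSpace M] [BorelSpace M] [MeasurableSpace M'] [BorelSpace M']

theorem chartVolume_transportChart [IsManifold (𝓡 d) ∞ M] {ζ : M ≃ₘ^∞⟮𝓡 d, 𝓡 d⟯ M'}
    (hζ : IsRiemannianIsometry ζ) {e : OpenPartialHomeomorph M (EuclideanSpace ℝ (Fin d))}
    (he : e ∈ IsManifold.maximalAtlas (𝓡 d) ∞ M) :
    chartVolume (transportChart ζ e) = (chartVolume e).map ζ := by
  have hm : AEMeasurable e.symm ((volume.restrict e.target).withDensity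
      (fun y => ENNReal.ofReal (volDensity e y))) :=
    (e.continuousOn_symm.aemeasurable e.open_target.measurableSet).mono_ac
      (withDensity_absolutelyContinuous _ _)
  unfold chartVolume
  rw [AEMeasurable.map_map_of_aemeasurable ζ.continuous.measurable.aemeasurable hm]
  change Measure.map (ζ ∘ e.symm) ((volume.restrict e.target).withDensity _) = _
  congr 1
  refine withDensity_congr_ae ?_
  filter_upwards [ae_restrict_mem e.open_target.measurableSet] with y hy
  unfold volDensity
  rw [gram_transportChart hζ he hy]

/-- Isometries preserve the Riemannian volume. -/
theorem IsRiemannianIsometry.measurePreserving [IsManifold (𝓡 d) ∞ M] [IsManifold (𝓡 d) ∞ M']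
    {ζ : M ≃ₘ^∞⟮𝓡 d, 𝓡 d⟯ M'} (hζ : IsRiemannianIsometry ζ) :
    MeasurePreserving ζ (riemannianVolume d M) (riemannianVolume d M') := by
  have hm : Measurable ζ := ζ.continuous.measurable
  have hm' : Measurable ζ.symm := ζ.symm.continuous.measurable
  refine ⟨hm, le_antisymm ?_ ?_⟩
  · have h : riemannianVolume d M ≤ (riemannianVolume d M').map ζ.symm := by
      refine iSup₂_le fun e he => ?_
      have h1 := Measure.map_mono (le_iSup₂_of_le (f := fun e' (_ : e' ∈
        IsManifold.maximalAtlas (𝓡 d) ∞ M') => chartVolume e')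
        _ (transportChart_mem ζ he) le_rfl) hm'
      refine le_trans (le_of_eq ?_) h1
      rw [chartVolume_transportChart hζ he, Measure.map_map hm' hm]
      have : ζ.symm ∘ ζ = id := funext ζ.symm_apply_apply
      rw [this, Measure.map_id]
    refine (Measure.map_mono h hm).trans (le_of_eq ?_)
    rw [Measure.map_map hm hm']
    have : ζ ∘ ζ.symm = id := funext ζ.apply_symm_apply
    rw [this, Measure.map_id]
  · refine iSup₂_le fun e he => ?_
    have he' := transportChart_mem ζ.symm he
    rw [← transportChart_symm_transportChart ζ e, chartVolume_transportChart hζ he']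
    exact Measure.map_mono (le_iSup₂_of_le (f := fun e' (_ : e' ∈
        IsManifold.maximalAtlas (𝓡 d) ∞ M) => chartVolume e') _ he' le_rfl) hm

theorem IsRiemannianIsometry.measurePreserving_symm
    [IsManifold (𝓡 d) ∞ M] [IsManifold (𝓡 d) ∞ M']
    {ζ : M ≃ₘ^∞⟮𝓡 d, 𝓡 d⟯ M'} (hζ : IsRiemannianIsometry ζ) :
    MeasurePreserving ζ.symm (riemannianVolume d M') (riemannianVolume d M) :=
  hζ.measurePreserving.symm ζ.toHomeomorph.toMeasurableEquiv

end Isometry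

section Spectral

variable {d : ℕ}
  {M : Type*} [TopologicalSpace M] [ChartedSpace (EuclideanSpace ℝ (Fin d)) M]
  [RiemannianBundle (fun x : M => TangentSpace (𝓡 d) x)] [MeasurableSpace M]
  {M' : Type*} [TopologicalSpace M'] [ChartedSpace (EuclideanSpace ℝ (Fin d)) M']
  [RiemannianBundle (fun x : M' => TangentSpace (𝓡 d) x)] [MeasurableSpace M']

variable (d M) in
/-- The Hilbert space of complex valued square integrable functions on the manifold. -/
abbrev L2 : Type _ := Lp ℂ 2 (riemannianVolume d M)

/-- The operator `V_ζ f = f ∘ ζ⁻¹`, for an isometry `ζ : M → M'`. -/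
def deformation [BorelSpace M] [BorelSpace M'] [IsManifold (𝓡 d) ∞ M] [IsManifold (𝓡 d) ∞ M']
    (ζ : M ≃ₘ^∞⟮𝓡 d, 𝓡 d⟯ M') (hζ : IsRiemannianIsometry ζ) : L2 d M →ₗᵢ[ℂ] L2 d M' :=
  Lp.compMeasurePreservingₗᵢ ℂ ζ.symm hζ.measurePreserving_symm

variable (d M) in
/-- An orthonormal basis of `L²` made of eigenfunctions of `-Δ`, in increasing order of the
eigenvalues, which are repeated according to their multiplicities. -/
structure LaplaceEigenbasis where
  /-- The orthonormal basis. -/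
  φ : HilbertBasis ℕ ℂ (L2 d M)
  /-- The eigenvalues. -/
  eig : ℕ → ℝ
  eig_mono : Monotone eig
  isEigen : ∀ k, ∃ u : M → ℂ, IsLaplaceEigenfunction (d := d) (eig k) u ∧
    φ k =ᵐ[riemannianVolume d M] u

namespace LaplaceEigenbasis

/-- The Fourier coefficient `∫ f(y) conj (φₖ(y)) dy`. -/
def coeff (B : LaplaceEigenbasis d M) (f : L2 d M) (k : ℕ) : ℂ :=
  inner ℂ (B.φ k) f

/-- `h` is a spectral filter if its Fourier coefficients depend only on the eigenvalue. -/
def IsSpectralFilter (B : LaplaceEigenbasis d M) (h : L2 d M) : Prop :=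
  ∀ k l, B.eig k = B.eig l → B.coeff h k = B.coeff h l

/-- `H` is a spectral function of `h`. -/
def IsSpectralFunction (B : LaplaceEigenbasis d M) (h : L2 d M) (H : ℝ → ℂ) : Prop :=
  ∀ k, H (B.eig k) = B.coeff h k

/-- The convolution operator `T_h f = ∑ₖ f̂(k) ĥ(k) φₖ`. The series converges in `L²`. -/
def conv (B : LaplaceEigenbasis d M) (h f : L2 d M) : L2 d M :=
  ∑' k, (B.coeff f k * B.coeff h k) • B.φ k

/-- `K(x, y) = ∑ₖ H(λₖ) φₖ(x) conj (φₖ(y))`, where the series converges in `L²(M × M)`. -/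
def IsSpectralKernel (B : LaplaceEigenbasis d M) (H : ℝ → ℂ) (K : M × M → ℂ) : Prop :=
  MemLp K 2 ((riemannianVolume d M).prod (riemannianVolume d M)) ∧
    Tendsto (fun n : ℕ => eLpNorm
      (fun p => K p - ∑ k ∈ Finset.range n,
        H (B.eig k) * (B.φ k p.1 * (starRingEnd ℂ) (B.φ k p.2)))
      2 ((riemannianVolume d M).prod (riemannianVolume d M))) atTop (𝓝 0)

end LaplaceEigenbasis

/-- `T` is the operator of integration against the kernel `K`. -/
def IsIntegralOperator (K : M × M → ℂ) (T : L2 d M →L[ℂ] L2 d M) : Prop :=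
  ∀ g : L2 d M, ∀ᵐ x ∂riemannianVolume d M,
    Integrable (fun y => K (x, y) * g y) (riemannianVolume d M) ∧
      T g x = ∫ y, K (x, y) * g y ∂riemannianVolume d M

end Spectral

end

set_option linter.unusedSectionVars false

/-! In the basis `B.φ` the operator `B.conv h` is diagonal, with square summable symbol `a k =
B.coeff h k`. Write `c l k` for the matrix entry `⟨φ'ₗ, V_ζ φₖ⟩`. Everything rests on one fact,
`inner_deformation_eq_zero`: `c l k = 0` unless `λ'ₗ = λₖ`. Where `c l k ≠ 0`, the symbol `H(λ'ₗ)`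
therefore equals `a k`, so `H(λ'ₗ) c l k = c l k a k` for all `k`, `l`. This is the intertwining
relation, entry by entry (`multiplier_comp_eq`). Part (1) is the same argument with a single basis,
the filter condition replacing `H`.

The fact itself combines two observations. The Laplacian is built from the metric, so an isometry
carries eigenfunctions to eigenfunctions with the same eigenvalue
(`IsLaplaceEigenfunction.comp_symm`). Eigenfunctions for distinct eigenvalues are orthogonal by
Green's formula (`integral_mul_eigenfunction`). Green's formula comes from integration by parts in a
chart and a partition of unity. It needs the Riemannian volume to be `√det g dy` in every chart and
the gradient pairing to be independent of the chart.

The kernel converges once `∑ |H(λ'ₗ)|²` is finite. Since `V_ζ` is unitary, `|c l k|²` is doubly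
stochastic, and it transfers summability from `a` to `H(λ'ₗ)` (`summable_norm_sq_of_intertwined`).
Eigenspaces and multiplicities of the two manifolds never have to be compared. The functions `φ'ₖ(x)
conj φ'ₖ(y)` are orthonormal, so the kernel series converges, and the Hilbert-Schmidt bound
identifies the integral operator with the multiplier. -/

noncomputable section

/-! ### Metric, volume density and gradient pairing under a change of chart. -/

section ChartGeometry

variable {d : ℕ} {M : Type*} [TopologicalSpace M] [ChartedSpace (EuclideanSpace ℝ (Fin d)) M]

/-- The derivative of the parametrization `e.symm`, as a map between model spaces. -/
def paramDeriv (e : OpenPartialHomeomorph M (EuclideanSpace ℝ (Fin d)))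
    (y : EuclideanSpace ℝ (Fin d)) :
    EuclideanSpace ℝ (Fin d) →L[ℝ] EuclideanSpace ℝ (Fin d) :=
  mfderiv (𝓡 d) (𝓡 d) e.symm y

/-- The change of coordinates from the chart `e'` to the chart `e`. -/
def transition (e' e : OpenPartialHomeomorph M (EuclideanSpace ℝ (Fin d))) :
    EuclideanSpace ℝ (Fin d) → EuclideanSpace ℝ (Fin d) :=
  e ∘ e'.symm

/-- The Jacobian matrix of the change of coordinates from `e'` to `e`. -/
def jacobian (e' e : OpenPartialHomeomorph M (EuclideanSpace ℝ (Fin d)))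
    (y : EuclideanSpace ℝ (Fin d)) : Matrix (Fin d) (Fin d) ℝ :=
  Matrix.of fun k i => fderiv ℝ (transition e' e) y (EuclideanSpace.single i (1 : ℝ)) k

theorem det_fderiv_transition (e' e : OpenPartialHomeomorph M (EuclideanSpace ℝ (Fin d)))
    (y : EuclideanSpace ℝ (Fin d)) :
    (fderiv ℝ (transition e' e) y).det = (jacobian e' e y).det := by
  rw [ContinuousLinearMap.det, ← LinearMap.det_toMatrix (EuclideanSpace.basisFun (Fin d) ℝ).toBasis]
  congr 1

theorem transition_eventuallyEq {e' e : OpenPartialHomeomorph M (EuclideanSpace ℝ (Fin d))}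
    {y : EuclideanSpace ℝ (Fin d)} (hy : y ∈ e'.target) (hy' : e'.symm y ∈ e.source) :
    e'.symm =ᶠ[𝓝 y] e.symm ∘ transition e' e := by
  have h : ∀ᶠ z in 𝓝 y, e'.symm z ∈ e.source :=
    (e'.continuousAt_symm hy).eventually (e.open_source.mem_nhds hy')
  filter_upwards [h] with z hz
  exact (e.left_inv hz).symm

theorem sum_coord_smul_single (v : EuclideanSpace ℝ (Fin d)) :
    v = ∑ i, v i • (EuclideanSpace.single i (1 : ℝ)) := by
  conv_lhs => rw [← (EuclideanSpace.basisFun (Fin d) ℝ).sum_repr v]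
  simp

section Smooth

variable [IsManifold (𝓡 d) ∞ M]

theorem contDiffAt_transition {e' e : OpenPartialHomeomorph M (EuclideanSpace ℝ (Fin d))}
    (he' : e' ∈ IsManifold.maximalAtlas (𝓡 d) ∞ M) (he : e ∈ IsManifold.maximalAtlas (𝓡 d) ∞ M)
    {y : EuclideanSpace ℝ (Fin d)} (hy : y ∈ e'.target) (hy' : e'.symm y ∈ e.source) :
    ContDiffAt ℝ ∞ (transition e' e) y :=
  ((contMDiffAt_of_mem_maximalAtlas he hy').comp y
    (contMDiffAt_symm_of_mem_maximalAtlas he' hy)).contDiffAt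

theorem paramDeriv_eq_comp {e' e : OpenPartialHomeomorph M (EuclideanSpace ℝ (Fin d))}
    (he' : e' ∈ IsManifold.maximalAtlas (𝓡 d) ∞ M) (he : e ∈ IsManifold.maximalAtlas (𝓡 d) ∞ M)
    {y : EuclideanSpace ℝ (Fin d)} (hy : y ∈ e'.target) (hy' : e'.symm y ∈ e.source) :
    paramDeriv e' y = (paramDeriv e (transition e' e y)).comp (fderiv ℝ (transition e' e) y) := by
  have h1 : MDifferentiableAt (𝓡 d) (𝓡 d) e.symm (transition e' e y) :=
    (contMDiffAt_symm_of_mem_maximalAtlas he (e.map_source hy')).mdifferentiableAt (by simp)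
  have h2 : MDifferentiableAt (𝓡 d) (𝓡 d) (transition e' e) y :=
    (contDiffAt_transition he' he hy hy').contMDiffAt.mdifferentiableAt (by simp)
  have h3 := mfderiv_comp y h1 h2
  rw [← mfderiv_eq_fderiv]
  refine Eq.trans ?_ h3
  exact (transition_eventuallyEq hy hy').mfderiv_eq

/-- The derivative of `e` is a left inverse. Injectivity is what makes the Gram matrix definite. -/
theorem paramDeriv_injective {e : OpenPartialHomeomorph M (EuclideanSpace ℝ (Fin d))}
    (he : e ∈ IsManifold.maximalAtlas (𝓡 d) ∞ M) {y : EuclideanSpace ℝ (Fin d)}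
    (hy : y ∈ e.target) : Function.Injective (paramDeriv e y) := by
  have h1 : MDifferentiableAt (𝓡 d) (𝓡 d) e (e.symm y) :=
    (contMDiffAt_of_mem_maximalAtlas he (e.map_target hy)).mdifferentiableAt (by simp)
  have h2 : MDifferentiableAt (𝓡 d) (𝓡 d) e.symm y :=
    (contMDiffAt_symm_of_mem_maximalAtlas he hy).mdifferentiableAt (by simp)
  have h3 : mfderiv (𝓡 d) (𝓡 d) (e ∘ e.symm) y = (mfderiv (𝓡 d) (𝓡 d) e (e.symm y)).comp
    (mfderiv (𝓡 d) (𝓡 d) e.symm y) := mfderiv_comp y h1 h2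
  have h4 : mfderiv (𝓡 d) (𝓡 d) (e ∘ e.symm) y = fderiv ℝ (e ∘ e.symm) y := mfderiv_eq_fderiv
  have h5 : e ∘ e.symm =ᶠ[𝓝 y] id := by
    filter_upwards [e.open_target.mem_nhds hy] with z hz
    exact e.right_inv hz
  rw [h4, h5.fderiv_eq, fderiv_id] at h3
  have h6 : ∀ v : EuclideanSpace ℝ (Fin d), v =
      (mfderiv (𝓡 d) (𝓡 d) e (e.symm y) :
        EuclideanSpace ℝ (Fin d) →L[ℝ] EuclideanSpace ℝ (Fin d)) (paramDeriv e y v) :=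
    fun v => congrArg (fun L : EuclideanSpace ℝ (Fin d) →L[ℝ] EuclideanSpace ℝ (Fin d) => L v) h3
  exact Function.LeftInverse.injective (fun v => (h6 v).symm)

theorem contDiffOn_comp_symm {e : OpenPartialHomeomorph M (EuclideanSpace ℝ (Fin d))}
    (he : e ∈ IsManifold.maximalAtlas (𝓡 d) ∞ M) {u : M → ℂ} (hu : ContMDiff (𝓡 d) 𝓘(ℝ, ℂ) ∞ u) :
    ContDiffOn ℝ ∞ (u ∘ e.symm) e.target :=
  (hu.comp_contMDiffOn (contMDiffOn_symm_of_mem_maximalAtlas he)).contDiffOn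

theorem contDiffOn_partialDeriv {U : Set (EuclideanSpace ℝ (Fin d))} (hU : IsOpen U)
    {F : EuclideanSpace ℝ (Fin d) → ℂ} (hF : ContDiffOn ℝ ∞ F U) (i : Fin d) :
    ContDiffOn ℝ ∞ (partialDeriv i F) U :=
  (hF.fderiv_of_isOpen hU (m := ∞) (by simp)).clm_apply contDiffOn_const

/-- The chain rule for a change of coordinates. -/
theorem partialDeriv_transition {e' e : OpenPartialHomeomorph M (EuclideanSpace ℝ (Fin d))}
    (he' : e' ∈ IsManifold.maximalAtlas (𝓡 d) ∞ M) (he : e ∈ IsManifold.maximalAtlas (𝓡 d) ∞ M)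
    {y : EuclideanSpace ℝ (Fin d)} (hy : y ∈ e'.target) (hy' : e'.symm y ∈ e.source)
    {u : M → ℂ} (hu : ContMDiff (𝓡 d) 𝓘(ℝ, ℂ) ∞ u) (i : Fin d) :
    partialDeriv i (u ∘ e'.symm) y = ∑ k, (jacobian e' e y k i : ℂ) *
      partialDeriv k (u ∘ e.symm) (transition e' e y) := by
  have h1 : u ∘ e'.symm =ᶠ[𝓝 y] (u ∘ e.symm) ∘ transition e' e :=
    (transition_eventuallyEq hy hy').fun_comp u
  have ht : transition e' e y ∈ e.target := e.map_source hy'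
  have h2 : DifferentiableAt ℝ (u ∘ e.symm) (transition e' e y) :=
    ((contDiffOn_comp_symm he hu).contDiffAt (e.open_target.mem_nhds ht)).differentiableAt
      (by simp)
  have h3 : DifferentiableAt ℝ (transition e' e) y :=
    (contDiffAt_transition he' he hy hy').differentiableAt (by simp)
  unfold partialDeriv
  rw [h1.fderiv_eq, fderiv_comp y h2 h3, ContinuousLinearMap.comp_apply,
    sum_coord_smul_single (fderiv ℝ (transition e' e) y (EuclideanSpace.single i 1)), map_sum]
  refine Finset.sum_congr rfl fun k _ => ?_
  rw [map_smul]
  simp [jacobian]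

end Smooth

variable [RiemannianBundle (fun x : M => TangentSpace (𝓡 d) x)]

/-- The Riemannian metric at a point, as a function on the model space. -/
def metricAt (x : M) (v w : EuclideanSpace ℝ (Fin d)) : ℝ :=
  @inner ℝ (TangentSpace (𝓡 d) x) _ v w

theorem metricAt_sum (x : M) (a b : Fin d → ℝ) (v w : Fin d → EuclideanSpace ℝ (Fin d)) :
    metricAt x (∑ k, a k • v k) (∑ l, b l • w l) = ∑ k, ∑ l, a k * b l * metricAt x (v k) (w l) := by
  have h : ∀ (v w : Fin d → TangentSpace (𝓡 d) x),
      (inner ℝ (∑ k, a k • v k) (∑ l, b l • w l) : ℝ) =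
        ∑ k, ∑ l, a k * b l * inner ℝ (v k) (w l) := fun v w => by
    simp only [sum_inner, inner_sum, real_inner_smul_left, real_inner_smul_right, mul_assoc]
    rw [Finset.sum_comm]
    exact Finset.sum_congr rfl fun k _ => Finset.sum_congr rfl fun l _ => by ring
  exact h v w

theorem metricAt_self_pos (x : M) {v : EuclideanSpace ℝ (Fin d)} (hv : v ≠ 0) :
    0 < metricAt x v v :=
  real_inner_self_pos.2 (show (v : TangentSpace (𝓡 d) x) ≠ 0 from hv)

theorem gram_apply (e : OpenPartialHomeomorph M (EuclideanSpace ℝ (Fin d)))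
    (y : EuclideanSpace ℝ (Fin d)) (i j : Fin d) :
    gram e y i j = metricAt (e.symm y) (paramDeriv e y (EuclideanSpace.single i (1 : ℝ)))
      (paramDeriv e y (EuclideanSpace.single j (1 : ℝ))) :=
  rfl

theorem gram_symm (e : OpenPartialHomeomorph M (EuclideanSpace ℝ (Fin d)))
    (y : EuclideanSpace ℝ (Fin d)) : (gram e y).transpose = gram e y := by
  ext i j
  exact @real_inner_comm (TangentSpace (𝓡 d) (e.symm y)) _ _ _ _

variable [IsManifold (𝓡 d) ∞ M]

/-- The quadratic form of the Gram matrix at `x` is the squared length of the tangent vector `∑ xᵢ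
∂ᵢ`, which is nonzero by `paramDeriv_injective`. -/
theorem gram_posDef {e : OpenPartialHomeomorph M (EuclideanSpace ℝ (Fin d))}
    (he : e ∈ IsManifold.maximalAtlas (𝓡 d) ∞ M) {y : EuclideanSpace ℝ (Fin d)}
    (hy : y ∈ e.target) : (gram e y).PosDef := by
  refine Matrix.PosDef.of_dotProduct_mulVec_pos ?_ fun x hx => ?_
  · ext i j
    exact @real_inner_comm (TangentSpace (𝓡 d) (e.symm y)) _ _ _ _
  · have h1 : paramDeriv e y (WithLp.toLp 2 x) ≠ 0 := by
      intro h
      have h0 := paramDeriv_injective he hy (h.trans (map_zero _).symm)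
      exact hx (by simpa using h0)
    have h2 : paramDeriv e y (WithLp.toLp 2 x) =
        ∑ i, x i • paramDeriv e y (EuclideanSpace.single i 1) := by
      rw [sum_coord_smul_single (WithLp.toLp 2 x), map_sum]
      exact Finset.sum_congr rfl fun k _ => by rw [map_smul]
    have h3 := metricAt_self_pos (e.symm y) h1
    rw [h2, metricAt_sum] at h3
    refine lt_of_lt_of_eq h3 ?_
    simp only [dotProduct, Matrix.mulVec, Finset.mul_sum, gram_apply, star_trivial]
    exact Finset.sum_congr rfl fun i _ => Finset.sum_congr rfl fun j _ => by ring

theorem gram_det_pos {e : OpenPartialHomeomorph M (EuclideanSpace ℝ (Fin d))}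
    (he : e ∈ IsManifold.maximalAtlas (𝓡 d) ∞ M) {y : EuclideanSpace ℝ (Fin d)}
    (hy : y ∈ e.target) : 0 < (gram e y).det :=
  (gram_posDef he hy).det_pos

theorem volDensity_pos {e : OpenPartialHomeomorph M (EuclideanSpace ℝ (Fin d))}
    (he : e ∈ IsManifold.maximalAtlas (𝓡 d) ∞ M) {y : EuclideanSpace ℝ (Fin d)}
    (hy : y ∈ e.target) : 0 < volDensity e y :=
  Real.sqrt_pos.2 (gram_det_pos he hy)

theorem gram_transition {e' e : OpenPartialHomeomorph M (EuclideanSpace ℝ (Fin d))}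
    (he' : e' ∈ IsManifold.maximalAtlas (𝓡 d) ∞ M) (he : e ∈ IsManifold.maximalAtlas (𝓡 d) ∞ M)
    {y : EuclideanSpace ℝ (Fin d)} (hy : y ∈ e'.target) (hy' : e'.symm y ∈ e.source) :
    gram e' y = (jacobian e' e y).transpose * gram e (transition e' e y) * jacobian e' e y := by
  have hx : e.symm (transition e' e y) = e'.symm y := e.left_inv hy'
  have h : ∀ i, paramDeriv e' y (EuclideanSpace.single i 1) = ∑ k, jacobian e' e y k i •
      paramDeriv e (transition e' e y) (EuclideanSpace.single k 1) := fun i => by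
    rw [paramDeriv_eq_comp he' he hy hy', ContinuousLinearMap.comp_apply,
      sum_coord_smul_single (fderiv ℝ (transition e' e) y (EuclideanSpace.single i 1)), map_sum]
    exact Finset.sum_congr rfl fun k _ => by rw [map_smul]; rfl
  ext i j
  rw [gram_apply, h, h, metricAt_sum]
  simp only [Matrix.mul_apply, Matrix.transpose_apply, Finset.sum_mul, gram_apply, hx]
  rw [Finset.sum_comm]
  exact Finset.sum_congr rfl fun i _ => Finset.sum_congr rfl fun j _ => by ring

/-- Taking determinants in `g' = Jᵀ g J` gives `det g' = (det J)² det g`. The root produces exactly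
the factor of the change of variables formula. -/
theorem volDensity_transition {e' e : OpenPartialHomeomorph M (EuclideanSpace ℝ (Fin d))}
    (he' : e' ∈ IsManifold.maximalAtlas (𝓡 d) ∞ M) (he : e ∈ IsManifold.maximalAtlas (𝓡 d) ∞ M)
    {y : EuclideanSpace ℝ (Fin d)} (hy : y ∈ e'.target) (hy' : e'.symm y ∈ e.source) :
    volDensity e' y = |(fderiv ℝ (transition e' e) y).det| * volDensity e (transition e' e y) := by
  unfold volDensity
  rw [gram_transition he' he hy hy', det_fderiv_transition, Matrix.det_mul, Matrix.det_mul,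
    Matrix.det_transpose, mul_right_comm, ← sq, Real.sqrt_mul (sq_nonneg _), Real.sqrt_sq_eq_abs]

/-- Otherwise `g' = Jᵀ g J` would be singular, against its positivity. -/
theorem jacobian_det_ne_zero {e' e : OpenPartialHomeomorph M (EuclideanSpace ℝ (Fin d))}
    (he' : e' ∈ IsManifold.maximalAtlas (𝓡 d) ∞ M) (he : e ∈ IsManifold.maximalAtlas (𝓡 d) ∞ M)
    {y : EuclideanSpace ℝ (Fin d)} (hy : y ∈ e'.target) (hy' : e'.symm y ∈ e.source) :
    (jacobian e' e y).det ≠ 0 := by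
  intro h
  have h1 := gram_det_pos he' hy
  rw [gram_transition he' he hy hy', Matrix.det_mul, h, mul_zero] at h1
  exact lt_irrefl _ h1

/-- The pairing `∑ᵢⱼ g^{ij} ∂ᵢ f ∂ⱼ u` of the gradients of `f` and `u` in the chart `e`. -/
def gradPair (e : OpenPartialHomeomorph M (EuclideanSpace ℝ (Fin d))) (f u : M → ℂ)
    (y : EuclideanSpace ℝ (Fin d)) : ℂ :=
  ∑ i : Fin d, partialDeriv i (f ∘ e.symm) y * ∑ j : Fin d,
    (((gram e y)⁻¹ i j : ℝ) : ℂ) * partialDeriv j (u ∘ e.symm) y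

theorem gradPair_eq_dotProduct (e : OpenPartialHomeomorph M (EuclideanSpace ℝ (Fin d)))
    (f u : M → ℂ) (y : EuclideanSpace ℝ (Fin d)) :
    gradPair e f u y = (fun i => partialDeriv i (f ∘ e.symm) y) ⬝ᵥ
      ((gram e y)⁻¹.map (algebraMap ℝ ℂ)).mulVec (fun j => partialDeriv j (u ∘ e.symm) y) :=
  rfl

/-- The pairing is bilinear, with no conjugation, so symmetry of `g⁻¹` is enough. -/
theorem gradPair_comm (e : OpenPartialHomeomorph M (EuclideanSpace ℝ (Fin d)))
    (f u : M → ℂ) (y : EuclideanSpace ℝ (Fin d)) : gradPair e f u y = gradPair e u f y := by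
  have h : ((gram e y)⁻¹).transpose = (gram e y)⁻¹ := by
    rw [Matrix.transpose_nonsing_inv, gram_symm]
  rw [gradPair_eq_dotProduct, gradPair_eq_dotProduct, Matrix.dotProduct_mulVec, dotProduct_comm,
    ← Matrix.mulVec_transpose, ← Matrix.transpose_map, h]

/-- Differentials transform by `Jᵀ` and the inverse metric by `J⁻¹ g⁻¹ (Jᵀ)⁻¹`, so the Jacobians
cancel. -/
theorem gradPair_transition {e' e : OpenPartialHomeomorph M (EuclideanSpace ℝ (Fin d))}
    (he' : e' ∈ IsManifold.maximalAtlas (𝓡 d) ∞ M) (he : e ∈ IsManifold.maximalAtlas (𝓡 d) ∞ M)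
    {y : EuclideanSpace ℝ (Fin d)} (hy : y ∈ e'.target) (hy' : e'.symm y ∈ e.source)
    {f u : M → ℂ} (hf : ContMDiff (𝓡 d) 𝓘(ℝ, ℂ) ∞ f) (hu : ContMDiff (𝓡 d) 𝓘(ℝ, ℂ) ∞ u) :
    gradPair e' f u y = gradPair e f u (transition e' e y) := by
  set J := jacobian e' e y with hJ
  have hd : IsUnit J.det := (jacobian_det_ne_zero he' he hy hy').isUnit
  have hα : ∀ {w : M → ℂ}, ContMDiff (𝓡 d) 𝓘(ℝ, ℂ) ∞ w →
      (fun i => partialDeriv i (w ∘ e'.symm) y) = (J.transpose.map (algebraMap ℝ ℂ)).mulVec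
        (fun k => partialDeriv k (w ∘ e.symm) (transition e' e y)) := fun hw => by
    ext i
    exact partialDeriv_transition he' he hy hy' hw i
  rw [gradPair_eq_dotProduct, gradPair_eq_dotProduct, hα hf, hα hu, gram_transition he' he hy hy',
    ← hJ, Matrix.mul_inv_rev, Matrix.mul_inv_rev, Matrix.mulVec_mulVec, ← Matrix.map_mul,
    dotProduct_comm, Matrix.dotProduct_mulVec, ← Matrix.mulVec_transpose, Matrix.mulVec_mulVec,
    ← Matrix.transpose_map, Matrix.transpose_transpose, ← Matrix.map_mul, dotProduct_comm]
  congr 4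
  have hd' : IsUnit J.transpose.det := by rwa [Matrix.det_transpose]
  rw [mul_assoc, mul_assoc, Matrix.nonsing_inv_mul _ hd', mul_one, ← mul_assoc,
    Matrix.mul_nonsing_inv _ hd, one_mul]

/-! ### Smoothness of the metric coefficients in a chart. -/

section Regularity

variable [IsContMDiffRiemannianBundle (𝓡 d) ∞ (EuclideanSpace ℝ (Fin d))
      (fun x : M => TangentSpace (𝓡 d) x)]

/-- The coordinate field is the tangent map of `e.symm` applied to a constant field, hence a smooth
section to which smoothness of the metric applies. -/
theorem contMDiffOn_coordField {e : OpenPartialHomeomorph M (EuclideanSpace ℝ (Fin d))}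
    (he : e ∈ IsManifold.maximalAtlas (𝓡 d) ∞ M) (i : Fin d) :
    ContMDiffOn (𝓡 d) ((𝓡 d).prod (𝓡 d)) ∞
      (fun y => (⟨e.symm y, coordField e i y⟩ : TangentBundle (𝓡 d) M)) e.target := by
  have : IsManifold (𝓡 d) 1 M := IsManifold.of_le (n := ∞) (by simp)
  have h1 := (contMDiffOn_symm_of_mem_maximalAtlas he).contMDiffOn_tangentMapWithin (m := ∞)
    (by simp) e.open_target.uniqueMDiffOn
  have h2 : ContMDiffOn (𝓡 d) ((𝓡 d).prod (𝓡 d)) ∞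
      (fun y => (⟨y, EuclideanSpace.single i (1 : ℝ)⟩ :
        TangentBundle (𝓡 d) (EuclideanSpace ℝ (Fin d)))) e.target := by
    exact contMDiffOn_vectorSpace_iff_contDiffOn.2 contDiffOn_const
  refine (h1.comp h2 (fun y hy => hy)).congr fun y hy => ?_
  have : mfderivWithin (𝓡 d) (𝓡 d) e.symm e.target y = mfderiv (𝓡 d) (𝓡 d) e.symm y :=
    mfderivWithin_of_isOpen e.open_target hy
  simp [tangentMapWithin, this, coordField]

theorem contDiffOn_gram {e : OpenPartialHomeomorph M (EuclideanSpace ℝ (Fin d))}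
    (he : e ∈ IsManifold.maximalAtlas (𝓡 d) ∞ M) (i j : Fin d) :
    ContDiffOn ℝ ∞ (fun y => gram e y i j) e.target :=
  (ContMDiffOn.inner_bundle (contMDiffOn_coordField he i) (contMDiffOn_coordField he j)).contDiffOn

theorem contDiffOn_matrix_det {E : Type*} [NormedAddCommGroup E] [NormedSpace ℝ E] {U : Set E}
    {A : E → Matrix (Fin d) (Fin d) ℝ} (hA : ∀ i j, ContDiffOn ℝ ∞ (fun y => A y i j) U) :
    ContDiffOn ℝ ∞ (fun y => (A y).det) U := by
  simp only [Matrix.det_apply']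
  exact ContDiffOn.sum fun σ _ => contDiffOn_const.mul (contDiffOn_prod fun i _ => hA _ _)

theorem contDiffOn_volDensity {e : OpenPartialHomeomorph M (EuclideanSpace ℝ (Fin d))}
    (he : e ∈ IsManifold.maximalAtlas (𝓡 d) ∞ M) : ContDiffOn ℝ ∞ (volDensity e) e.target :=
  (contDiffOn_matrix_det (contDiffOn_gram he)).sqrt fun _ hy => (gram_det_pos he hy).ne'

theorem contDiffOn_gram_inv {e : OpenPartialHomeomorph M (EuclideanSpace ℝ (Fin d))}
    (he : e ∈ IsManifold.maximalAtlas (𝓡 d) ∞ M) (i j : Fin d) :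
    ContDiffOn ℝ ∞ (fun y => (gram e y)⁻¹ i j) e.target := by
  -- Cramer's rule: each entry of the adjugate is the determinant of the Gram matrix with row `j`
  -- replaced by a constant vector.
  have h1 : ContDiffOn ℝ ∞ (fun y => (gram e y).adjugate i j) e.target := by
    simp only [Matrix.adjugate_apply]
    refine contDiffOn_matrix_det fun k l => ?_
    by_cases hk : k = j
    · subst hk
      simpa using contDiffOn_const
    · simpa [Matrix.updateRow_ne hk] using contDiffOn_gram he k l
  have h2 := (contDiffOn_matrix_det (contDiffOn_gram he)).inv fun _ hy => (gram_det_pos he hy).ne'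
  refine (h2.mul h1).congr fun y hy => ?_
  simp [Matrix.inv_def]

/-- The vector field `√(det g) g^{ij} ∂ⱼ u` in the chart `e`. -/
def flux (e : OpenPartialHomeomorph M (EuclideanSpace ℝ (Fin d))) (u : M → ℂ) (i : Fin d)
    (z : EuclideanSpace ℝ (Fin d)) : ℂ :=
  (volDensity e z : ℂ) * ∑ j : Fin d,
      (((gram e z)⁻¹ i j : ℝ) : ℂ) * partialDeriv j (u ∘ e.symm) z

theorem contDiffOn_ofReal {U : Set (EuclideanSpace ℝ (Fin d))} {f : EuclideanSpace ℝ (Fin d) → ℝ}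
    (hf : ContDiffOn ℝ ∞ f U) : ContDiffOn ℝ ∞ (fun y => (f y : ℂ)) U :=
  Complex.ofRealCLM.contDiff.comp_contDiffOn hf

theorem contDiffOn_flux {e : OpenPartialHomeomorph M (EuclideanSpace ℝ (Fin d))}
    (he : e ∈ IsManifold.maximalAtlas (𝓡 d) ∞ M) {u : M → ℂ} (hu : ContMDiff (𝓡 d) 𝓘(ℝ, ℂ) ∞ u)
    (i : Fin d) : ContDiffOn ℝ ∞ (flux e u i) e.target :=
  (contDiffOn_ofReal (contDiffOn_volDensity he)).mul <| ContDiffOn.sum fun j _ =>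
    (contDiffOn_ofReal (contDiffOn_gram_inv he i j)).mul
      (contDiffOn_partialDeriv e.open_target (contDiffOn_comp_symm he hu) j)

theorem contDiffOn_gradPair {e : OpenPartialHomeomorph M (EuclideanSpace ℝ (Fin d))}
    (he : e ∈ IsManifold.maximalAtlas (𝓡 d) ∞ M) {f u : M → ℂ}
    (hf : ContMDiff (𝓡 d) 𝓘(ℝ, ℂ) ∞ f) (hu : ContMDiff (𝓡 d) 𝓘(ℝ, ℂ) ∞ u) :
    ContDiffOn ℝ ∞ (gradPair e f u) e.target :=
  ContDiffOn.sum fun i _ =>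
    (contDiffOn_partialDeriv e.open_target (contDiffOn_comp_symm he hf) i).mul <|
    ContDiffOn.sum fun j _ => (contDiffOn_ofReal (contDiffOn_gram_inv he i j)).mul
      (contDiffOn_partialDeriv e.open_target (contDiffOn_comp_symm he hu) j)

end Regularity

end ChartGeometry

/-! ### The Riemannian volume in a chart. -/

section Volume

variable {d : ℕ} {M : Type*} [TopologicalSpace M] [ChartedSpace (EuclideanSpace ℝ (Fin d)) M]
  [RiemannianBundle (fun x : M => TangentSpace (𝓡 d) x)] [MeasurableSpace M] [BorelSpace M]

/-- Only continuity of `e.symm` on `e.target` is known, so measurability is obtained on the subtype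
and then pushed forward. -/
theorem measurableSet_target_inter_preimage
    (e : OpenPartialHomeomorph M (EuclideanSpace ℝ (Fin d))) {A : Set M} (hA : MeasurableSet A) :
    MeasurableSet (e.symm ⁻¹' A ∩ e.target) := by
  have h1 : Measurable (e.target.domRestrict e.symm) :=
    (continuousOn_iff_continuous_domRestrict.1 e.continuousOn_symm).measurable
  have h2 := e.open_target.measurableSet.subtype_image (h1 hA)
  convert h2 using 1
  ext y
  simp [and_comm]

theorem aemeasurable_symm_withDensity (e : OpenPartialHomeomorph M (EuclideanSpace ℝ (Fin d))) :
    AEMeasurable e.symm ((volume.restrict e.target).withDensity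
      (fun y => ENNReal.ofReal (volDensity e y))) :=
  (e.continuousOn_symm.aemeasurable e.open_target.measurableSet).mono_ac
    (withDensity_absolutelyContinuous _ _)

theorem chartVolume_apply (e : OpenPartialHomeomorph M (EuclideanSpace ℝ (Fin d))) {A : Set M}
    (hA : MeasurableSet A) : chartVolume e A =
      ∫⁻ y in e.symm ⁻¹' A ∩ e.target, ENNReal.ofReal (volDensity e y) := by
  unfold chartVolume
  rw [Measure.map_apply_of_aemeasurable (aemeasurable_symm_withDensity e) hA, withDensity_apply',
    Measure.restrict_restrict' e.open_target.measurableSet]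

theorem chartVolume_restrict_source (e : OpenPartialHomeomorph M (EuclideanSpace ℝ (Fin d))) :
    (chartVolume e).restrict e.source = chartVolume e := by
  refine Measure.restrict_eq_self_of_ae_mem ?_
  change chartVolume e e.sourceᶜ = 0
  rw [chartVolume_apply e e.open_source.measurableSet.compl]
  have : e.symm ⁻¹' e.sourceᶜ ∩ e.target = ∅ := by
    ext y
    simpa using fun h hy => h (e.map_target hy)
  rw [this, Measure.restrict_empty, lintegral_zero_measure]

variable [IsManifold (𝓡 d) ∞ M]

/-- Change of variables on the overlap. An inequality suffices below, so the image of `S` under the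
transition map need not be determined, only enclosed. -/
theorem chartVolume_restrict_le {e' e : OpenPartialHomeomorph M (EuclideanSpace ℝ (Fin d))}
    (he' : e' ∈ IsManifold.maximalAtlas (𝓡 d) ∞ M)
    (he : e ∈ IsManifold.maximalAtlas (𝓡 d) ∞ M) :
    (chartVolume e').restrict e.source ≤ chartVolume e := by
  refine Measure.le_iff.2 fun A hA => ?_
  have hB := hA.inter e.open_source.measurableSet
  rw [Measure.restrict_apply hA, chartVolume_apply e' hB, chartVolume_apply e hA]
  set S := e'.symm ⁻¹' (A ∩ e.source) ∩ e'.target with hS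
  have hSm : MeasurableSet S := measurableSet_target_inter_preimage e' hB
  have hd : ∀ y ∈ S, HasFDerivWithinAt (transition e' e) (fderiv ℝ (transition e' e) y) S y :=
    fun y hy => ((contDiffAt_transition he' he hy.2 hy.1.2).differentiableAt
      (by simp)).hasFDerivAt.hasFDerivWithinAt
  have hl : ∀ y ∈ S, e.symm (transition e' e y) = e'.symm y := fun y hy => e.left_inv hy.1.2
  have hinj : Set.InjOn (transition e' e) S := fun y hy z hz hyz =>
    e'.symm.injOn hy.2 hz.2 (by rw [← hl y hy, ← hl z hz, hyz])
  calc ∫⁻ y in S, ENNReal.ofReal (volDensity e' y)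
      = ∫⁻ y in S, ENNReal.ofReal |(fderiv ℝ (transition e' e) y).det| *
          ENNReal.ofReal (volDensity e (transition e' e y)) := by
        refine setLIntegral_congr_fun hSm fun y hy => ?_
        rw [← ENNReal.ofReal_mul (abs_nonneg _), ← volDensity_transition he' he hy.2 hy.1.2]
    _ = ∫⁻ y in transition e' e '' S, ENNReal.ofReal (volDensity e y) :=
        (lintegral_image_eq_lintegral_abs_det_fderiv_mul volume hSm hd hinj
          (fun y => ENNReal.ofReal (volDensity e y))).symm
    _ ≤ _ := by
        refine lintegral_mono_set ?_
        rintro _ ⟨y, hy, rfl⟩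
        exact ⟨by rw [Set.mem_preimage, hl y hy]; exact hy.1.1, e.map_source hy.1.2⟩

theorem chartVolume_le_riemannianVolume
    {e : OpenPartialHomeomorph M (EuclideanSpace ℝ (Fin d))}
    (he : e ∈ IsManifold.maximalAtlas (𝓡 d) ∞ M) : chartVolume e ≤ riemannianVolume d M :=
  le_iSup₂_of_le (f := fun e' (_ : e' ∈ IsManifold.maximalAtlas (𝓡 d) ∞ M) => chartVolume e')
    e he le_rfl

/-- On the domain of a smooth chart, the Riemannian volume is the volume in this chart. -/
theorem riemannianVolume_restrict_source
    {e : OpenPartialHomeomorph M (EuclideanSpace ℝ (Fin d))}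
    (he : e ∈ IsManifold.maximalAtlas (𝓡 d) ∞ M) :
    (riemannianVolume d M).restrict e.source = chartVolume e := by
  have hm := e.open_source.measurableSet
  refine le_antisymm ?_ ?_
  -- Each `chartVolume e'` is split along `e.source`. The resulting bound does not depend on `e'`,
  -- so it passes to the supremum.
  · have h : riemannianVolume d M ≤
        chartVolume e + (riemannianVolume d M).restrict e.sourceᶜ := by
      refine iSup₂_le fun e' he' => ?_
      rw [← Measure.restrict_add_restrict_compl (μ := chartVolume e') hm]
      exact add_le_add (chartVolume_restrict_le he' he)
        (Measure.restrict_mono le_rfl (chartVolume_le_riemannianVolume he'))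
    refine (Measure.restrict_mono le_rfl h).trans (le_of_eq ?_)
    rw [Measure.restrict_add, Measure.restrict_restrict hm, Set.inter_compl_self,
      Measure.restrict_empty, add_zero, chartVolume_restrict_source]
  · rw [← chartVolume_restrict_source]
    exact Measure.restrict_mono le_rfl (chartVolume_le_riemannianVolume he)

variable [IsContMDiffRiemannianBundle (𝓡 d) ∞ (EuclideanSpace ℝ (Fin d))
      (fun x : M => TangentSpace (𝓡 d) x)]

/-- The density is continuous, hence integrable over a compact coordinate neighbourhood. On a
compact manifold the volume is then finite. -/
instance riemannianVolume_isLocallyFinite :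
    IsLocallyFiniteMeasure (riemannianVolume d M) := by
  refine ⟨fun x => ?_⟩
  set e := chartAt (EuclideanSpace ℝ (Fin d)) x
  have he : e ∈ IsManifold.maximalAtlas (𝓡 d) ∞ M := IsManifold.chart_mem_maximalAtlas x
  have hx : x ∈ e.source := mem_chart_source _ x
  obtain ⟨K, hK, hxK, hKt⟩ := exists_compact_subset e.open_target (e.map_source hx)
  have hU : IsOpen (e.source ∩ e ⁻¹' interior K) := e.isOpen_inter_preimage isOpen_interior
  refine ⟨_, hU.mem_nhds ⟨hx, hxK⟩, ?_⟩
  -- Intersecting the neighbourhood with `e.source` again exposes the restricted measure, which is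
  -- `chartVolume e`.
  rw [← Set.inter_eq_left.2 (Set.inter_subset_left (s := e.source) (t := e ⁻¹' interior K)),
    ← Measure.restrict_apply hU.measurableSet, riemannianVolume_restrict_source he,
    chartVolume_apply e hU.measurableSet]
  have hint : IntegrableOn (volDensity e) K :=
    ((contDiffOn_volDensity he).continuousOn.mono hKt).integrableOn_compact hK
  refine lt_of_le_of_lt (lintegral_mono_set ?_) hint.lintegral_lt_top
  rintro y ⟨hy, hyt⟩
  have := interior_subset hy.2
  rwa [e.right_inv hyt] at this

/-- The integral of a function which vanishes outside the domain of a smooth chart. -/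
theorem integral_riemannianVolume_eq {e : OpenPartialHomeomorph M (EuclideanSpace ℝ (Fin d))}
    (he : e ∈ IsManifold.maximalAtlas (𝓡 d) ∞ M) {F : M → ℂ} (hF : Continuous F)
    (hF0 : ∀ x ∉ e.source, F x = 0) :
    ∫ x, F x ∂riemannianVolume d M =
      ∫ y in e.target, (volDensity e y : ℂ) * F (e.symm y) := by
  have hm : AEMeasurable (fun y => ENNReal.ofReal (volDensity e y)) (volume.restrict e.target) :=
    ((contDiffOn_volDensity he).continuousOn.aemeasurable
      e.open_target.measurableSet).ennreal_ofReal
  rw [← setIntegral_eq_integral_of_forall_compl_eq_zero hF0, riemannianVolume_restrict_source he,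
    chartVolume, integral_map (aemeasurable_symm_withDensity e)
      (hF.measurable.aestronglyMeasurable),
    integral_withDensity_eq_integral_toReal_smul₀ hm (ae_of_all _ fun _ => ENNReal.ofReal_lt_top)]
  refine integral_congr_ae (ae_of_all _ fun y => ?_)
  simp [ENNReal.toReal_ofReal (Real.sqrt_nonneg _), volDensity]

end Volume

/-! ### Green's formula and orthogonality of eigenfunctions. -/

section Green

variable {d : ℕ} {M : Type*} [TopologicalSpace M] [T2Space M] [CompactSpace M]
  [ChartedSpace (EuclideanSpace ℝ (Fin d)) M]

/-- The expression in a chart of a function on the manifold, extended by zero. -/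
def chartExtend (e : OpenPartialHomeomorph M (EuclideanSpace ℝ (Fin d))) (f : M → ℂ) :
    EuclideanSpace ℝ (Fin d) → ℂ :=
  e.target.indicator (f ∘ e.symm)

section Extend

variable {e : OpenPartialHomeomorph M (EuclideanSpace ℝ (Fin d))} {f : M → ℂ}

theorem isCompact_image_tsupport (hfe : tsupport f ⊆ e.source) : IsCompact (e '' tsupport f) :=
  (isClosed_tsupport f).isCompact.image_of_continuousOn (e.continuousOn.mono hfe)

theorem image_tsupport_subset (hfe : tsupport f ⊆ e.source) : e '' tsupport f ⊆ e.target :=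
  Set.image_subset_iff.2 fun _ hx => e.map_source (hfe hx)

theorem chartExtend_eq_zero {y : EuclideanSpace ℝ (Fin d)} (hy : y ∉ e '' tsupport f) :
    chartExtend e f y = 0 := by
  by_cases hyt : y ∈ e.target
  · rw [chartExtend, Set.indicator_of_mem hyt]
    exact image_eq_zero_of_notMem_tsupport (f := f) fun h => hy ⟨_, h, e.right_inv hyt⟩
  · exact Set.indicator_of_notMem hyt _

theorem tsupport_chartExtend_subset (hfe : tsupport f ⊆ e.source) :
    tsupport (chartExtend e f) ⊆ e '' tsupport f :=
  closure_minimal (fun _ hy => by_contra fun h => hy (chartExtend_eq_zero h))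
    (isCompact_image_tsupport hfe).isClosed

theorem hasCompactSupport_chartExtend (hfe : tsupport f ⊆ e.source) :
    HasCompactSupport (chartExtend e f) :=
  (isCompact_image_tsupport hfe).of_isClosed_subset (isClosed_tsupport _)
    (tsupport_chartExtend_subset hfe)

theorem chartExtend_eventuallyEq {y : EuclideanSpace ℝ (Fin d)} (hy : y ∈ e.target) :
    chartExtend e f =ᶠ[𝓝 y] f ∘ e.symm := by
  filter_upwards [e.open_target.mem_nhds hy] with z hz
  exact Set.indicator_of_mem hz _

theorem contDiff_chartExtend [IsManifold (𝓡 d) ∞ M] (he : e ∈ IsManifold.maximalAtlas (𝓡 d) ∞ M)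
    (hf : ContMDiff (𝓡 d) 𝓘(ℝ, ℂ) ∞ f) (hfe : tsupport f ⊆ e.source) :
    ContDiff ℝ ∞ (chartExtend e f) := by
  refine contDiff_iff_contDiffAt.2 fun y => ?_
  by_cases hy : y ∈ e.target
  · exact ((contDiffOn_comp_symm he hf).contDiffAt (e.open_target.mem_nhds hy)).congr_of_eventuallyEq
      (chartExtend_eventuallyEq hy)
  · have h : y ∈ (e '' tsupport f)ᶜ := fun h => hy (image_tsupport_subset hfe h)
    refine (contDiffAt_const (c := (0 : ℂ))).congr_of_eventuallyEq ?_
    filter_upwards [(isCompact_image_tsupport hfe).isClosed.isOpen_compl.mem_nhds h] with z hz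
    exact chartExtend_eq_zero hz

/-- Nothing is assumed of `F` outside `U`: the product vanishes near every point outside the support
of `w`. -/
theorem integrable_mul_of_tsupport_subset {U : Set (EuclideanSpace ℝ (Fin d))} (hU : IsOpen U)
    {w F : EuclideanSpace ℝ (Fin d) → ℂ} (hw : Continuous w) (hwc : HasCompactSupport w)
    (hwU : tsupport w ⊆ U) (hF : ContinuousOn F U) : Integrable (fun y => w y * F y) := by
  have hts : tsupport (fun y => w y * F y) ⊆ tsupport w := tsupport_mul_subset_left
  refine Continuous.integrable_of_hasCompactSupport ?_
    (hwc.of_isClosed_subset (isClosed_tsupport _) hts)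
  refine continuous_of_tsupport fun y hy => ?_
  exact hw.continuousAt.mul (hF.continuousAt (hU.mem_nhds (hwU (hts hy))))

theorem partialDeriv_chartExtend {y : EuclideanSpace ℝ (Fin d)} (hy : y ∈ e.target) (i : Fin d) :
    partialDeriv i (chartExtend e f) y = partialDeriv i (f ∘ e.symm) y := by
  unfold partialDeriv
  rw [(chartExtend_eventuallyEq hy).fderiv_eq]

theorem tsupport_partialDeriv_subset (w : EuclideanSpace ℝ (Fin d) → ℂ) (i : Fin d) :
    tsupport (partialDeriv i w) ⊆ tsupport w := by
  refine (closure_mono fun y hy => ?_).trans (tsupport_fderiv_subset ℝ (f := w))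
  intro h
  exact hy (by simp [partialDeriv, h])

end Extend

variable [RiemannianBundle (fun x : M => TangentSpace (𝓡 d) x)] [IsManifold (𝓡 d) ∞ M]
  [IsContMDiffRiemannianBundle (𝓡 d) ∞ (EuclideanSpace ℝ (Fin d))
      (fun x : M => TangentSpace (𝓡 d) x)]

/-- Green's formula in a chart. -/
theorem integral_mul_chartLaplacian {e : OpenPartialHomeomorph M (EuclideanSpace ℝ (Fin d))}
    (he : e ∈ IsManifold.maximalAtlas (𝓡 d) ∞ M) {f v : M → ℂ}
    (hf : ContMDiff (𝓡 d) 𝓘(ℝ, ℂ) ∞ f) (hfe : tsupport f ⊆ e.source)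
    (hv : ContMDiff (𝓡 d) 𝓘(ℝ, ℂ) ∞ v) :
    ∫ y in e.target, (volDensity e y : ℂ) * (f (e.symm y) * chartLaplacian e v y) =
      -∫ y in e.target, (volDensity e y : ℂ) * gradPair e f v y := by
  set w := chartExtend e f with hwdef
  have hw : ContDiff ℝ ∞ w := contDiff_chartExtend he hf hfe
  have hwc : HasCompactSupport w := hasCompactSupport_chartExtend hfe
  have hwt : tsupport w ⊆ e.target :=
    (tsupport_chartExtend_subset hfe).trans (image_tsupport_subset hfe)
  have hflux := fun i => contDiffOn_flux he hv i
  have hdw : ∀ i, Continuous (partialDeriv i w) := fun i =>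
    (hw.continuous_fderiv (by simp)).clm_apply continuous_const
  have hdc : ∀ i, HasCompactSupport (partialDeriv i w) := fun i =>
    hwc.of_isClosed_subset (isClosed_tsupport _) (tsupport_partialDeriv_subset w i)
  have hI1 : ∀ i, Integrable (fun y => partialDeriv i w y * flux e v i y) := fun i =>
    integrable_mul_of_tsupport_subset e.open_target (hdw i) (hdc i)
      ((tsupport_partialDeriv_subset w i).trans hwt) (hflux i).continuousOn
  have hI2 : ∀ i, Integrable (fun y => w y * partialDeriv i (flux e v i) y) := fun i =>
    integrable_mul_of_tsupport_subset e.open_target hw.continuous hwc hwt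
      (contDiffOn_partialDeriv e.open_target (hflux i) i).continuousOn
  have hI3 : ∀ i, Integrable (fun y => w y * flux e v i y) := fun i =>
    integrable_mul_of_tsupport_subset e.open_target hw.continuous hwc hwt (hflux i).continuousOn
  -- The flux is differentiable only on `e.target`, and integration by parts asks for this only on
  -- the support of `w`.
  have hparts : ∀ i, ∫ y, w y * partialDeriv i (flux e v i) y =
      -∫ y, partialDeriv i w y * flux e v i y := fun i =>
    integral_mul_fderiv_eq_neg_fderiv_mul_of_integrable (v := EuclideanSpace.single i (1 : ℝ))
      (hI1 i) (hI2 i) (hI3 i)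
      (fun y _ => hw.differentiable (by simp) y)
      (fun y hy => ((hflux i).contDiffAt (e.open_target.mem_nhds (hwt hy))).differentiableAt
        (by simp))
  -- The density of the volume cancels the factor `(√det g)⁻¹` of the Laplacian, leaving a pure
  -- divergence.
  have hL : ∫ y in e.target, (volDensity e y : ℂ) * (f (e.symm y) * chartLaplacian e v y) =
      ∫ y, ∑ i, w y * partialDeriv i (flux e v i) y := by
    refine Eq.trans ?_ (setIntegral_eq_integral_of_forall_compl_eq_zero (s := e.target) ?_)
    · refine setIntegral_congr_fun e.open_target.measurableSet fun y hy => ?_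
      have h1 : (volDensity e y : ℂ) ≠ 0 := Complex.ofReal_ne_zero.2 (volDensity_pos he hy).ne'
      have h2 : w y = f (e.symm y) := Set.indicator_of_mem hy _
      simp only [h2, ← Finset.mul_sum, chartLaplacian, Complex.ofReal_inv]
      change (volDensity e y : ℂ) * (f (e.symm y) * ((volDensity e y : ℂ)⁻¹ *
        ∑ i, partialDeriv i (flux e v i) y)) = _
      field_simp
    · intro y hy
      have : w y = 0 := Set.indicator_of_notMem hy _
      simp [this]
  have hR : ∫ y in e.target, (volDensity e y : ℂ) * gradPair e f v y =
      ∫ y, ∑ i, partialDeriv i w y * flux e v i y := by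
    refine Eq.trans ?_ (setIntegral_eq_integral_of_forall_compl_eq_zero (s := e.target) ?_)
    · refine setIntegral_congr_fun e.open_target.measurableSet fun y hy => ?_
      simp only [gradPair, hwdef, partialDeriv_chartExtend hy, flux]
      rw [Finset.mul_sum]
      exact Finset.sum_congr rfl fun i _ => by ring
    · intro y hy
      refine Finset.sum_eq_zero fun i _ => ?_
      rw [image_eq_zero_of_notMem_tsupport
        fun h => hy (hwt (tsupport_partialDeriv_subset w i h)), zero_mul]
  rw [hL, hR, integral_finsetSum _ fun i _ => hI2 i, integral_finsetSum _ fun i _ => hI1 i,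
    ← Finset.sum_neg_distrib]
  exact Finset.sum_congr rfl fun i _ => hparts i

/-- The pairing of the gradients of two functions. -/
def gradPairing (f u : M → ℂ) (x : M) : ℂ :=
  gradPair (chartAt (EuclideanSpace ℝ (Fin d)) x) f u (chartAt (EuclideanSpace ℝ (Fin d)) x x)

/-- The preferred chart at `x` in the definition of `gradPairing` is an arbitrary choice, and
`gradPair_transition` removes it. -/
theorem gradPairing_eq {e : OpenPartialHomeomorph M (EuclideanSpace ℝ (Fin d))}
    (he : e ∈ IsManifold.maximalAtlas (𝓡 d) ∞ M) {f u : M → ℂ}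
    (hf : ContMDiff (𝓡 d) 𝓘(ℝ, ℂ) ∞ f) (hu : ContMDiff (𝓡 d) 𝓘(ℝ, ℂ) ∞ u) {x : M}
    (hx : x ∈ e.source) : gradPairing (d := d) f u x = gradPair e f u (e x) := by
  have hx' := mem_chart_source (EuclideanSpace ℝ (Fin d)) x
  have hl := (chartAt (EuclideanSpace ℝ (Fin d)) x).left_inv hx'
  unfold gradPairing
  rw [gradPair_transition (IsManifold.chart_mem_maximalAtlas x) he
    ((chartAt (EuclideanSpace ℝ (Fin d)) x).map_source hx') (by rwa [hl]) hf hu]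
  simp [transition, hl]

theorem continuous_gradPairing {f u : M → ℂ} (hf : ContMDiff (𝓡 d) 𝓘(ℝ, ℂ) ∞ f)
    (hu : ContMDiff (𝓡 d) 𝓘(ℝ, ℂ) ∞ u) : Continuous (gradPairing (d := d) f u) := by
  refine continuous_iff_continuousAt.2 fun x => ?_
  set e := chartAt (EuclideanSpace ℝ (Fin d)) x
  have he : e ∈ IsManifold.maximalAtlas (𝓡 d) ∞ M := IsManifold.chart_mem_maximalAtlas x
  have hx : x ∈ e.source := mem_chart_source _ x
  have h1 : ContinuousAt (gradPair e f u ∘ e) x :=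
    ((contDiffOn_gradPair he hf hu).continuousOn.continuousAt
      (e.open_target.mem_nhds (e.map_source hx))).comp (e.continuousAt hx)
  refine h1.congr ?_
  filter_upwards [e.open_source.mem_nhds hx] with z hz
  exact (gradPairing_eq he hf hu hz).symm

/-- Off the topological support `f` vanishes on a whole neighbourhood, so its derivatives vanish
too. -/
theorem gradPairing_eq_zero {f u : M → ℂ} {x : M} (hx : x ∉ tsupport f) :
    gradPairing (d := d) f u x = 0 := by
  set e := chartAt (EuclideanSpace ℝ (Fin d)) x with hedef
  have hxs : x ∈ e.source := mem_chart_source _ x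
  have h : f ∘ e.symm =ᶠ[𝓝 (e x)] fun _ => 0 := by
    have h1 : ∀ᶠ y in 𝓝 (e x), e.symm y ∈ (tsupport f)ᶜ := by
      refine (e.continuousAt_symm (e.map_source hxs)).eventually ?_
      rw [e.left_inv hxs]
      exact (isClosed_tsupport f).isOpen_compl.mem_nhds hx
    filter_upwards [h1] with y hy
    exact image_eq_zero_of_notMem_tsupport (f := f) hy
  unfold gradPairing gradPair
  refine Finset.sum_eq_zero fun i _ => ?_
  have h2 : partialDeriv i (f ∘ e.symm) (e x) = 0 := by
    unfold partialDeriv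
    rw [h.fderiv_eq]
    simp
  rw [← hedef, h2, zero_mul]

theorem gradPairing_sum {ι : Type*} (s : Finset ι) {f : ι → M → ℂ} {u : M → ℂ}
    (hf : ∀ i, ContMDiff (𝓡 d) 𝓘(ℝ, ℂ) ∞ (f i)) (x : M) :
    gradPairing (d := d) (fun z => ∑ i ∈ s, f i z) u x =
      ∑ i ∈ s, gradPairing (d := d) (f i) u x := by
  set e := chartAt (EuclideanSpace ℝ (Fin d)) x with hedef
  have he : e ∈ IsManifold.maximalAtlas (𝓡 d) ∞ M := IsManifold.chart_mem_maximalAtlas x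
  have hxt : e x ∈ e.target := e.map_source (mem_chart_source _ x)
  have h : ∀ k, partialDeriv k ((fun z => ∑ i ∈ s, f i z) ∘ e.symm) (e x) =
      ∑ i ∈ s, partialDeriv k (f i ∘ e.symm) (e x) := fun k => by
    unfold partialDeriv
    have : (fun z => ∑ i ∈ s, f i z) ∘ e.symm = fun y => ∑ i ∈ s, (f i ∘ e.symm) y := rfl
    rw [this, fderiv_fun_sum fun i _ => ((contDiffOn_comp_symm he (hf i)).contDiffAt
      (e.open_target.mem_nhds hxt)).differentiableAt (by simp)]
    simp
  unfold gradPairing gradPair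
  simp only [← hedef, h, Finset.sum_mul]
  exact Finset.sum_comm

variable [MeasurableSpace M] [BorelSpace M]

/-- Green's formula, for a function supported in the domain of a chart. -/
theorem integral_mul_eigenfunction_of_tsupport_subset
    {e : OpenPartialHomeomorph M (EuclideanSpace ℝ (Fin d))}
    (he : e ∈ IsManifold.maximalAtlas (𝓡 d) ∞ M) {f v : M → ℂ}
    (hf : ContMDiff (𝓡 d) 𝓘(ℝ, ℂ) ∞ f) (hfe : tsupport f ⊆ e.source) {lam : ℝ}
    (hv : IsLaplaceEigenfunction (d := d) lam v) :
    ∫ x, f x * (lam * v x) ∂riemannianVolume d M =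
      ∫ x, gradPairing (d := d) f v x ∂riemannianVolume d M := by
  rw [integral_riemannianVolume_eq (F := fun x => f x * (lam * v x)) he
      (hf.continuous.mul (continuous_const.mul hv.1.continuous))
      (fun x hx => by rw [image_eq_zero_of_notMem_tsupport fun h => hx (hfe h), zero_mul]),
    integral_riemannianVolume_eq he (continuous_gradPairing hf hv.1)
      (fun x hx => gradPairing_eq_zero fun h => hx (hfe h))]
  have h1 : ∫ y in e.target, (volDensity e y : ℂ) * (f (e.symm y) * (lam * v (e.symm y))) =
      -∫ y in e.target, (volDensity e y : ℂ) * (f (e.symm y) * chartLaplacian e v y) := by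
    rw [← integral_neg]
    refine setIntegral_congr_fun e.open_target.measurableSet fun y hy => ?_
    have := hv.2 e he _ (e.map_target hy)
    rw [e.right_inv hy] at this
    simp only [← this]
    ring
  rw [h1, integral_mul_chartLaplacian he hf hfe hv.1, neg_neg]
  refine setIntegral_congr_fun e.open_target.measurableSet fun y hy => ?_
  simp only [gradPairing_eq he hf hv.1 (e.map_target hy), e.right_inv hy]

variable (d M) in
/-- A finite smooth partition of unity subordinate to charts. -/
theorem exists_chart_partition : ∃ (s : Finset M) (ρ : M → M → ℂ),
    (∀ i, ContMDiff (𝓡 d) 𝓘(ℝ, ℂ) ∞ (ρ i)) ∧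
    (∀ i, tsupport (ρ i) ⊆ (chartAt (EuclideanSpace ℝ (Fin d)) i).source) ∧
    ∀ x, ∑ i ∈ s, ρ i x = 1 := by
  obtain ⟨ρ, hρ⟩ := SmoothPartitionOfUnity.exists_isSubordinate_chartAt_source (𝓡 d) M
  have hfin := ρ.locallyFinite.finite_nonempty_of_compact
  refine ⟨hfin.toFinset, fun i x => (ρ i x : ℂ), fun i => ?_, fun i => ?_, fun x => ?_⟩
  · exact Complex.ofRealCLM.contDiff.contMDiff.comp (ρ i).contMDiff
  · refine (closure_mono fun x hx => ?_).trans (hρ i)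
    intro h
    exact hx (by simp [h])
  · have h1 := ρ.sum_eq_one (Set.mem_univ x)
    rw [finsum_eq_sum_of_support_subset (s := hfin.toFinset)] at h1
    · simpa using congrArg (fun t : ℝ => (t : ℂ)) h1
    · intro i hi
      simp only [Set.Finite.coe_toFinset, Set.mem_ofPred_eq]
      exact ⟨x, hi⟩

theorem integrable_of_continuous {F : M → ℂ} (hF : Continuous F) :
    Integrable F (riemannianVolume d M) :=
  hF.integrable_of_hasCompactSupport (HasCompactSupport.of_compactSpace F)

/-- Green's formula on a compact manifold. -/
theorem integral_mul_eigenfunction {f v : M → ℂ} (hf : ContMDiff (𝓡 d) 𝓘(ℝ, ℂ) ∞ f) {lam : ℝ}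
    (hv : IsLaplaceEigenfunction (d := d) lam v) :
    ∫ x, f x * (lam * v x) ∂riemannianVolume d M =
      ∫ x, gradPairing (d := d) f v x ∂riemannianVolume d M := by
  obtain ⟨s, ρ, hρ, hρs, hρ1⟩ := exists_chart_partition d M
  -- Only `f` is cut into pieces, since `ρ i * v` would not be an eigenfunction. This is why Green's
  -- formula is stated for an arbitrary smooth `f`.
  have hg : ∀ i, ContMDiff (𝓡 d) 𝓘(ℝ, ℂ) ∞ (fun x => ρ i x * f x) := fun i =>
    (contDiff_mul (𝕜 := ℝ) (𝔸 := ℂ)).contMDiff.comp ((hρ i).prodMk_space hf)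
  have hf' : f = fun x => ∑ i ∈ s, ρ i x * f x := by
    ext x
    rw [← Finset.sum_mul, hρ1, one_mul]
  have h1 : ∀ x, f x * (lam * v x) = ∑ i ∈ s, (ρ i x * f x) * (lam * v x) := fun x => by
    rw [← Finset.sum_mul, ← Finset.sum_mul, hρ1, one_mul]
  have h2 : ∀ x, gradPairing (d := d) f v x =
      ∑ i ∈ s, gradPairing (d := d) (fun x => ρ i x * f x) v x := fun x => by
    rw [← gradPairing_sum s hg, ← hf']
  simp only [h1, h2]
  rw [integral_finsetSum (f := fun i x => (ρ i x * f x) * (lam * v x)) _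
      fun i _ => integrable_of_continuous ((hg i).continuous.mul (continuous_const.mul hv.1.continuous)),
    integral_finsetSum _ fun i _ => integrable_of_continuous (continuous_gradPairing (hg i) hv.1)]
  exact Finset.sum_congr rfl fun i _ => integral_mul_eigenfunction_of_tsupport_subset
    (IsManifold.chart_mem_maximalAtlas i) (hg i) (tsupport_mul_subset_left.trans (hρs i)) hv

theorem gradPairing_comm (f u : M → ℂ) (x : M) :
    gradPairing (d := d) f u x = gradPairing (d := d) u f x :=
  gradPair_comm _ _ _ _

/-- Green's formula applied in both orders, with the symmetry of the pairing, gives `mu ∫ u v = lam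
∫ u v`. -/
theorem integral_mul_eq_zero_of_eigenvalue_ne {u v : M → ℂ} {lam mu : ℝ}
    (hu : IsLaplaceEigenfunction (d := d) lam u) (hv : IsLaplaceEigenfunction (d := d) mu v)
    (h : lam ≠ mu) : ∫ x, u x * v x ∂riemannianVolume d M = 0 := by
  have h1 := integral_mul_eigenfunction hu.1 hv
  have h2 := integral_mul_eigenfunction hv.1 hu
  simp only [gradPairing_comm v u] at h2
  rw [← h2] at h1
  have h3 : ∀ x, u x * (mu * v x) = mu * (u x * v x) := fun x => by ring
  have h4 : ∀ x, v x * (lam * u x) = lam * (u x * v x) := fun x => by ring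
  simp only [h3, h4, integral_const_mul] at h1
  have h5 : (lam : ℂ) ≠ mu := fun h' => h (Complex.ofReal_injective h')
  by_contra h6
  exact h5 (mul_right_cancel₀ h6 h1.symm)

end Green

/-! ### Eigenfunctions under conjugation and under isometries. -/

section Eigenfunctions

variable {d : ℕ} {M : Type*} [TopologicalSpace M] [ChartedSpace (EuclideanSpace ℝ (Fin d)) M]
  [RiemannianBundle (fun x : M => TangentSpace (𝓡 d) x)]

theorem partialDeriv_conj (i : Fin d) (F : EuclideanSpace ℝ (Fin d) → ℂ)
    (y : EuclideanSpace ℝ (Fin d)) :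
    partialDeriv i (fun z => (starRingEnd ℂ) (F z)) y = (starRingEnd ℂ) (partialDeriv i F y) := by
  have h : fderiv ℝ (Complex.conjCLE ∘ F) y = _ := ContinuousLinearEquiv.comp_fderiv _
  exact congrArg (fun L : EuclideanSpace ℝ (Fin d) →L[ℝ] ℂ => L (EuclideanSpace.single i 1)) h

theorem chartLaplacian_conj (e : OpenPartialHomeomorph M (EuclideanSpace ℝ (Fin d))) (u : M → ℂ)
    (y : EuclideanSpace ℝ (Fin d)) :
    chartLaplacian e (fun x => (starRingEnd ℂ) (u x)) y =
      (starRingEnd ℂ) (chartLaplacian e u y) := by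
  have h1 : ∀ j z, partialDeriv j ((fun x => (starRingEnd ℂ) (u x)) ∘ e.symm) z =
      (starRingEnd ℂ) (partialDeriv j (u ∘ e.symm) z) := fun j z => partialDeriv_conj j _ z
  unfold chartLaplacian
  simp only [h1, map_mul, map_sum, Complex.conj_ofReal, ← partialDeriv_conj]

/-- The metric coefficients and `lam` are real. Conjugation turns the Hermitian inner product into
the bilinear integral that Green's formula handles. -/
theorem IsLaplaceEigenfunction.conj {lam : ℝ} {u : M → ℂ}
    (hu : IsLaplaceEigenfunction (d := d) lam u) :
    IsLaplaceEigenfunction (d := d) lam (fun x => (starRingEnd ℂ) (u x)) := by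
  refine ⟨?_, fun e he x hx => ?_⟩
  · exact Complex.conjCLE.toContinuousLinearMap.contDiff.contMDiff.comp hu.1
  · rw [chartLaplacian_conj, ← map_neg, hu.2 e he x hx, map_mul, Complex.conj_ofReal]

variable {M' : Type*} [TopologicalSpace M'] [ChartedSpace (EuclideanSpace ℝ (Fin d)) M']
  [RiemannianBundle (fun x : M' => TangentSpace (𝓡 d) x)]
  [IsManifold (𝓡 d) ∞ M] [IsManifold (𝓡 d) ∞ M']

/-- In the transported chart both the Gram matrix and the function have the same coordinate
expressions as in `e`. The Gram matrices agree only on `e.target`, which is open, and that suffices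
for derivatives. -/
theorem chartLaplacian_transportChart {ζ : M ≃ₘ^∞⟮𝓡 d, 𝓡 d⟯ M'} (hζ : IsRiemannianIsometry ζ)
    {e : OpenPartialHomeomorph M (EuclideanSpace ℝ (Fin d))}
    (he : e ∈ IsManifold.maximalAtlas (𝓡 d) ∞ M) (u : M → ℂ) {y : EuclideanSpace ℝ (Fin d)}
    (hy : y ∈ e.target) :
    chartLaplacian (transportChart ζ e) (u ∘ ζ.symm) y = chartLaplacian e u y := by
  have h1 : (u ∘ ζ.symm) ∘ (transportChart ζ e).symm = u ∘ e.symm := by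
    ext z
    exact congrArg u (ζ.symm_apply_apply _)
  have h2 : ∀ z ∈ e.target, gram (transportChart ζ e) z = gram e z :=
    fun z hz => gram_transportChart hζ he hz
  unfold chartLaplacian volDensity
  rw [h1, h2 y hy]
  congr 1
  refine Finset.sum_congr rfl fun i _ => ?_
  unfold partialDeriv
  refine congrArg (fun L : EuclideanSpace ℝ (Fin d) →L[ℝ] ℂ => L (EuclideanSpace.single i 1))
    (EventuallyEq.fderiv_eq ?_)
  filter_upwards [e.open_target.mem_nhds hy] with z hz
  rw [h2 z hz]

theorem IsLaplaceEigenfunction.comp_symm {ζ : M ≃ₘ^∞⟮𝓡 d, 𝓡 d⟯ M'}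
    (hζ : IsRiemannianIsometry ζ) {lam : ℝ} {u : M → ℂ}
    (hu : IsLaplaceEigenfunction (d := d) lam u) :
    IsLaplaceEigenfunction (d := d) lam (u ∘ ζ.symm) := by
  refine ⟨hu.1.comp ζ.symm.contMDiff, fun e' he' x hx => ?_⟩
  -- Every chart `e'` of `M'` is the transport of a chart of `M`, namely of its pullback by `ζ`.
  have he := transportChart_mem ζ.symm he'
  have hxs : ζ.symm x ∈ (transportChart ζ.symm e').source := by
    change ζ (ζ.symm x) ∈ e'.source
    rwa [ζ.apply_symm_apply]
  have hex : transportChart ζ.symm e' (ζ.symm x) = e' x := congrArg e' (ζ.apply_symm_apply x)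
  have h := chartLaplacian_transportChart hζ he u
    ((transportChart ζ.symm e').map_source hxs)
  rw [transportChart_symm_transportChart, hex] at h
  rw [h, ← hex]
  exact hu.2 _ he _ hxs

variable [MeasurableSpace M] [BorelSpace M] [MeasurableSpace M'] [BorelSpace M']

theorem coeFn_deformation {ζ : M ≃ₘ^∞⟮𝓡 d, 𝓡 d⟯ M'} (hζ : IsRiemannianIsometry ζ) (f : L2 d M) :
    deformation ζ hζ f =ᵐ[riemannianVolume d M'] f ∘ ζ.symm :=
  Lp.coeFn_compMeasurePreserving f hζ.measurePreserving_symm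

theorem deformation_surjective {ζ : M ≃ₘ^∞⟮𝓡 d, 𝓡 d⟯ M'} (hζ : IsRiemannianIsometry ζ) :
    Function.Surjective (deformation ζ hζ) := by
  intro g
  refine ⟨Lp.compMeasurePreserving ζ hζ.measurePreserving g, Lp.ext ?_⟩
  refine (coeFn_deformation hζ _).trans ?_
  have h := hζ.measurePreserving_symm.quasiMeasurePreserving.ae_eq_comp
    (Lp.coeFn_compMeasurePreserving g hζ.measurePreserving)
  refine h.trans (ae_of_all _ fun x => ?_)
  exact congrArg g (ζ.apply_symm_apply x)

/-- An isometry maps the eigenfunctions for an eigenvalue to functions orthogonal to the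
eigenfunctions for all other eigenvalues. -/
theorem inner_deformation_eq_zero [T2Space M'] [CompactSpace M']
    [IsContMDiffRiemannianBundle (𝓡 d) ∞ (EuclideanSpace ℝ (Fin d))
      (fun x : M' => TangentSpace (𝓡 d) x)]
    (B : LaplaceEigenbasis d M) (B' : LaplaceEigenbasis d M') {ζ : M ≃ₘ^∞⟮𝓡 d, 𝓡 d⟯ M'}
    (hζ : IsRiemannianIsometry ζ) {k l : ℕ} (h : B'.eig l ≠ B.eig k) :
    inner ℂ (B'.φ l) (deformation ζ hζ (B.φ k)) = 0 := by
  obtain ⟨u, hu, hφu⟩ := B.isEigen k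
  obtain ⟨v, hv, hφv⟩ := B'.isEigen l
  rw [L2.inner_def]
  refine Eq.trans (integral_congr_ae ?_)
    (integral_mul_eq_zero_of_eigenvalue_ne hv.conj (hu.comp_symm hζ) h)
  filter_upwards [hφv, coeFn_deformation hζ (B.φ k),
    hζ.measurePreserving_symm.quasiMeasurePreserving.ae_eq_comp hφu] with x h1 h2 h3
  rw [h1, h2, h3, RCLike.inner_apply, mul_comm]

end Eigenfunctions

/-! ### Diagonal operators in two orthonormal bases. -/

section Multiplier

variable {E E' : Type*} [NormedAddCommGroup E] [InnerProductSpace ℂ E]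
  [NormedAddCommGroup E'] [InnerProductSpace ℂ E']

theorem HilbertBasis.hasSum_norm_inner_sq (b : HilbertBasis ℕ ℂ E) (x : E) :
    HasSum (fun k => ‖inner ℂ (b k) x‖ ^ 2) (‖x‖ ^ 2) := by
  have h := Complex.hasSum_re (b.hasSum_inner_mul_inner x x)
  convert h using 1
  · ext k
    rw [← inner_conj_symm x (b k), Complex.conj_mul', ← Complex.ofReal_pow, Complex.ofReal_re]
  · exact (inner_self_eq_norm_sq (𝕜 := ℂ) x).symm

theorem HilbertBasis.ext_inner (b : HilbertBasis ℕ ℂ E) {x y : E}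
    (h : ∀ k, inner ℂ (b k) x = inner ℂ (b k) y) : x = y := by
  refine b.repr.injective (lp.ext (funext fun k => ?_))
  rw [b.repr_apply_apply, b.repr_apply_apply, h]

/-- The operator which multiplies the coefficients in an orthonormal basis by `a`. -/
theorem HilbertBasis.exists_multiplier (b : HilbertBasis ℕ ℂ E) {a : ℕ → ℂ}
    (ha : Summable fun k => ‖a k‖ ^ 2) :
    ∃ T : E →L[ℂ] E, ∀ f k, inner ℂ (b k) (T f) = a k * inner ℂ (b k) f := by
  -- A single term is at most the whole sum, so the symbol is bounded; `√C` bounds the operator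
  -- norm.
  obtain ⟨C, hC⟩ : ∃ C, ∀ k, ‖a k‖ ^ 2 ≤ C := ⟨_, fun k => ha.le_tsum k fun _ _ => sq_nonneg _⟩
  have hC0 : 0 ≤ C := (sq_nonneg _).trans (hC 0)
  have hle : ∀ f k, ‖a k * inner ℂ (b k) f‖ ^ 2 ≤ C * ‖inner ℂ (b k) f‖ ^ 2 := fun f k => by
    rw [norm_mul, mul_pow]
    exact mul_le_mul_of_nonneg_right (hC k) (sq_nonneg _)
  have hmem : ∀ f, Memℓp (fun k => a k * inner ℂ (b k) f) 2 := fun f => by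
    refine memℓp_gen ?_
    simp only [ENNReal.toReal_ofNat, Real.rpow_two]
    exact Summable.of_nonneg_of_le (fun _ => sq_nonneg _) (hle f)
      ((b.hasSum_norm_inner_sq f).summable.mul_left C)
  let L : E →ₗ[ℂ] E :=
    { toFun := fun f => b.repr.symm ⟨_, hmem f⟩
      map_add' := fun f g => by
        rw [← map_add]
        congr 1
        ext k
        exact (congrArg (a k * ·) (inner_add_right _ _ _)).trans (mul_add _ _ _)
      map_smul' := fun c f => by
        rw [RingHom.id_apply, ← map_smul]
        congr 1
        ext k
        exact (congrArg (a k * ·) (inner_smul_right _ _ _)).trans (mul_left_comm _ _ _) }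
  have hL : ∀ f k, inner ℂ (b k) (L f) = a k * inner ℂ (b k) f := fun f k => by
    rw [← b.repr_apply_apply]
    simp [L]
  refine ⟨L.mkContinuous (Real.sqrt C) fun f => ?_, hL⟩
  refine abs_le_of_sq_le_sq' ?_ (by positivity) |>.2
  rw [mul_pow, Real.sq_sqrt hC0]
  refine hasSum_le (fun k => ?_) (b.hasSum_norm_inner_sq (L f))
    ((b.hasSum_norm_inner_sq f).mul_left C)
  rw [hL]
  exact hle f k

/-- Multipliers whose symbols agree where `V` has nonzero matrix entries are intertwined
by `V`. -/
theorem multiplier_comp_eq (b : HilbertBasis ℕ ℂ E) (b' : HilbertBasis ℕ ℂ E') (V : E →ₗᵢ[ℂ] E')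
    {a a' : ℕ → ℂ} (hV : ∀ k l, inner ℂ (b' l) (V (b k)) ≠ 0 → a' l = a k)
    {T : E →L[ℂ] E} (hT : ∀ f k, inner ℂ (b k) (T f) = a k * inner ℂ (b k) f)
    {T' : E' →L[ℂ] E'} (hT' : ∀ f k, inner ℂ (b' k) (T' f) = a' k * inner ℂ (b' k) f) (f : E) :
    T' (V f) = V (T f) := by
  have hsum : ∀ g l, HasSum (fun k => inner ℂ (b k) g * inner ℂ (b' l) (V (b k)))
      (inner ℂ (b' l) (V g)) := fun g l => by
    have h := ((innerSL ℂ (b' l)).comp V.toContinuousLinearMap).hasSum (b.hasSum_repr g)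
    simpa [inner_smul_right, b.repr_apply_apply] using h
  refine b'.ext_inner fun l => ?_
  rw [hT']
  refine ((hsum f l).mul_left (a' l)).unique ?_
  refine (congrArg (fun s : ℕ → ℂ => HasSum s (inner ℂ (b' l) (V (T f))))
    (funext fun k => ?_)).mpr (hsum (T f) l)
  rw [hT]
  by_cases h : inner ℂ (b' l) (V (b k)) = 0
  · simp [h]
  · rw [hV k l h, mul_assoc]

/-- Two sequences intertwined by a doubly stochastic matrix are summable together. -/
theorem summable_of_doubly_stochastic {p q : ℕ → ℝ} {c : ℕ → ℕ → ℝ} (hp : ∀ k, 0 ≤ p k)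
    (hc : ∀ k l, 0 ≤ c k l) (hpq : ∀ k l, p k * c k l = q l * c k l) (h1 : ∀ k, HasSum (c k) 1)
    (h2 : ∀ l, HasSum (fun k => c k l) 1) (hs : Summable p) : Summable q := by
  have h0 : 0 ≤ fun i : ℕ × ℕ => p i.1 * c i.1 i.2 := fun i => mul_nonneg (hp _) (hc _ _)
  have hk : ∀ k, ∑' l, p k * c k l = p k := fun k => by
    rw [tsum_mul_left, (h1 k).tsum_eq, mul_one]
  have hl : ∀ l, ∑' k, p k * c k l = q l := fun l => by
    rw [tsum_congr fun k => hpq k l, tsum_mul_left, (h2 l).tsum_eq, mul_one]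
  have hkl : ∀ k, Summable fun l => p k * c k l := fun k => (h1 k).summable.mul_left (p k)
  have hks : Summable fun k => ∑' l, p k * c k l := by simpa only [hk] using hs
  -- Tonelli for `p k * c k l`: the sums over `l` give `p`, the sums over `k` give `q`.
  have h3 : Summable fun i : ℕ × ℕ => p i.1 * c i.1 i.2 :=
    (summable_prod_of_nonneg h0).2 ⟨hkl, hks⟩
  have h4 : Summable fun l => ∑' k, p k * c k l := h3.prod_symm.prod
  simpa only [hl] using h4

/-- The weights `‖⟨b'ₗ, V bₖ⟩‖²` are doubly stochastic by Parseval. For fixed `k` this uses that `V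
bₖ` is a unit vector; for fixed `l`, that surjectivity makes `b'ₗ` the image of a unit vector. -/
theorem summable_norm_sq_of_intertwined (b : HilbertBasis ℕ ℂ E) (b' : HilbertBasis ℕ ℂ E')
    (V : E →ₗᵢ[ℂ] E') (hVs : Function.Surjective V) {a a' : ℕ → ℂ}
    (hV : ∀ k l, inner ℂ (b' l) (V (b k)) ≠ 0 → a' l = a k) (ha : Summable fun k => ‖a k‖ ^ 2) :
    Summable fun l => ‖a' l‖ ^ 2 := by
  refine summable_of_doubly_stochastic (c := fun k l => ‖inner ℂ (b' l) (V (b k))‖ ^ 2)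
    (fun k => sq_nonneg _) (fun k l => sq_nonneg _) (fun k l => ?_) (fun k => ?_) (fun l => ?_) ha
  · by_cases h : inner ℂ (b' l) (V (b k)) = 0
    · simp [h]
    · rw [hV k l h]
  · have h := b'.hasSum_norm_inner_sq (V (b k))
    rwa [V.norm_map, b.orthonormal.1 k, one_pow] at h
  · obtain ⟨w, hw⟩ := hVs (b' l)
    have h := b.hasSum_norm_inner_sq w
    rw [← V.norm_map, hw, b'.orthonormal.1 l, one_pow] at h
    refine (congrArg (fun s : ℕ → ℝ => HasSum s 1) (funext fun k => ?_)).mpr h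
    rw [← hw, V.inner_map_map, norm_inner_symm]

end Multiplier

/-! ### Square integrable kernels and their operators. -/

section Kernel

variable {X : Type*} [MeasurableSpace X] {μ : Measure X} [SFinite μ]

/-- The Hilbert-Schmidt bound for integral operators. -/
theorem eLpNorm_integral_mul_le {R : X × X → ℂ} (hR : AEStronglyMeasurable R (μ.prod μ))
    {g : X → ℂ} (hg : AEStronglyMeasurable g μ) :
    eLpNorm (fun x => ∫ y, R (x, y) * g y ∂μ) 2 μ ≤ eLpNorm R 2 (μ.prod μ) * eLpNorm g 2 μ := by
  have hN : ∀ (α : Type _) [MeasurableSpace α] (ν : Measure α) (f : α → ℂ),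
      eLpNorm f 2 ν ^ 2 = ∫⁻ x, ‖f x‖ₑ ^ 2 ∂ν := fun α _ ν f => by
    rw [eLpNorm_eq_lintegral_rpow_enorm_toReal (by simp) (by simp)]
    simp only [ENNReal.toReal_ofNat, ENNReal.rpow_ofNat]
    rw [← ENNReal.rpow_natCast, ← ENNReal.rpow_mul]
    norm_num
  -- Cauchy-Schwarz in `y` for almost every fixed `x`; integrating in `x` gives the bound.
  have hx : ∀ᵐ x ∂μ, ‖∫ y, R (x, y) * g y ∂μ‖ₑ ^ 2 ≤
      (∫⁻ y, ‖R (x, y)‖ₑ ^ 2 ∂μ) * eLpNorm g 2 μ ^ 2 := by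
    filter_upwards [hR.prodMk_left] with x hx
    rw [← hN X μ (fun y => R (x, y)), ← mul_pow]
    refine pow_le_pow_left' ?_ 2
    refine (enorm_integral_le_lintegral_enorm _).trans ?_
    rw [← eLpNorm_one_eq_lintegral_enorm]
    have := eLpNorm_le_eLpNorm_mul_eLpNorm_of_nnnorm (p := 2) (q := 2) (r := 1) hx hg
      (fun a b => a * b) 1 (ae_of_all _ fun y => by simp)
    simpa using this
  have h2 : eLpNorm (fun x => ∫ y, R (x, y) * g y ∂μ) 2 μ ^ 2 ≤
      (eLpNorm R 2 (μ.prod μ) * eLpNorm g 2 μ) ^ 2 := by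
    rw [hN, mul_pow, hN (X × X), lintegral_prod _ (hR.enorm.pow_const 2)]
    refine (lintegral_mono_ae hx).trans (le_of_eq ?_)
    rw [lintegral_mul_const'' _ (hR.enorm.pow_const 2).lintegral_prod_right']
  exact (ENNReal.pow_le_pow_left_iff two_ne_zero).1 h2

theorem ae_memLp_section {K : X × X → ℂ} (hK : MemLp K 2 (μ.prod μ)) :
    ∀ᵐ x ∂μ, MemLp (fun y => K (x, y)) 2 μ := by
  have h := (memLp_two_iff_integrable_sq_norm hK.1).1 hK
  filter_upwards [hK.1.prodMk_left, h.prod_right_ae] with x h1 h2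
  exact (memLp_two_iff_integrable_sq_norm h1).2 h2

/-- The function `(x, y) ↦ φ(x) conj (ψ(y))`. -/
def tensorConj (φ ψ : Lp ℂ 2 μ) (p : X × X) : ℂ :=
  φ p.1 * (starRingEnd ℂ) (ψ p.2)

theorem memLp_tensorConj (φ ψ : Lp ℂ 2 μ) : MemLp (tensorConj φ ψ) 2 (μ.prod μ) := by
  have hφ := Lp.memLp φ
  have hψ := (Lp.memLp ψ).star
  have hm : AEStronglyMeasurable (tensorConj φ ψ) (μ.prod μ) := hφ.1.comp_fst.mul hψ.1.comp_snd
  refine (memLp_two_iff_integrable_sq_norm hm).2 ?_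
  have h := ((memLp_two_iff_integrable_sq_norm hφ.1).1 hφ).mul_prod
    ((memLp_two_iff_integrable_sq_norm hψ.1).1 hψ)
  refine h.congr (ae_of_all _ fun p => ?_)
  simp [tensorConj, mul_pow]

/-- The second factor is reversed by the conjugate in `tensorConj`. For a basis `b` it follows that
the functions `tensorConj (b k) (b k)` are orthonormal. -/
theorem inner_tensorConj (φ φ' ψ ψ' : Lp ℂ 2 μ) :
    inner ℂ ((memLp_tensorConj φ ψ).toLp _) ((memLp_tensorConj φ' ψ').toLp _) =
      inner ℂ φ φ' * inner ℂ ψ' ψ := by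
  rw [L2.inner_def, L2.inner_def, L2.inner_def, ← integral_prod_mul]
  refine integral_congr_ae ?_
  filter_upwards [(memLp_tensorConj φ ψ).coeFn_toLp, (memLp_tensorConj φ' ψ').coeFn_toLp]
    with p h1 h2
  rw [h1, h2]
  simp only [RCLike.inner_apply, tensorConj, map_mul, Complex.conj_conj]
  ring

/-- A multiplier with square summable symbol has a square integrable kernel. -/
theorem exists_kernel (b : HilbertBasis ℕ ℂ (Lp ℂ 2 μ)) {a : ℕ → ℂ}
    (ha : Summable fun k => ‖a k‖ ^ 2) :
    ∃ K : X × X → ℂ, MemLp K 2 (μ.prod μ) ∧ Tendsto (fun n : ℕ => eLpNorm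
      (fun p => K p - ∑ k ∈ Finset.range n, a k * tensorConj (b k) (b k) p) 2 (μ.prod μ))
      atTop (𝓝 0) := by
  set t : ℕ → Lp ℂ 2 (μ.prod μ) := fun k => (memLp_tensorConj (b k) (b k)).toLp _ with ht
  have hort : Orthonormal ℂ t := by
    rw [orthonormal_iff_ite]
    intro i j
    rw [ht, inner_tensorConj, orthonormal_iff_ite.1 b.orthonormal i j,
      orthonormal_iff_ite.1 b.orthonormal j i]
    by_cases h : i = j
    · simp [h]
    · simp [h, Ne.symm h]
  have hs : Summable fun k => a k • t k := by
    have := (hort.orthogonalFamily.summable_iff_norm_sq_summable a).2 ha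
    simpa using this
  have h := hs.hasSum.tendsto_sum_nat
  set S := ∑' k, a k • t k with hS
  refine ⟨S, Lp.memLp S, ?_⟩
  have h1 := (Lp.tendsto_Lp_iff_tendsto_eLpNorm' _ _).1 h
  refine h1.congr fun n => ?_
  rw [← eLpNorm_neg]
  refine eLpNorm_congr_ae ?_
  have h2 : ⇑(∑ k ∈ Finset.range n, a k • t k) =ᵐ[μ.prod μ]
      fun p => ∑ k ∈ Finset.range n, a k * tensorConj (b k) (b k) p := by
    have h3 : ∀ k, ⇑(a k • t k) =ᵐ[μ.prod μ] fun p => a k * tensorConj (b k) (b k) p := fun k => by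
      filter_upwards [Lp.coeFn_smul (a k) (t k), (memLp_tensorConj (b k) (b k)).coeFn_toLp]
        with p h4 h5
      rw [h4, Pi.smul_apply, ht, h5, smul_eq_mul]
    filter_upwards [Lp.coeFn_finsetSum (Finset.range n) (fun k => a k • t k), ae_all_iff.2 h3]
      with p h4 h5
    rw [h4, Finset.sum_apply]
    exact Finset.sum_congr rfl fun k _ => h5 k
  filter_upwards [h2] with p hp
  rw [Pi.neg_apply, Pi.sub_apply, hp, neg_sub]

/-- A kernel which is the sum of the series `∑ₖ aₖ φₖ(x) conj (φₖ(y))` is the kernel of the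
multiplier with symbol `a`. -/
theorem multiplier_eq_integral (b : HilbertBasis ℕ ℂ (Lp ℂ 2 μ)) {a : ℕ → ℂ} {K : X × X → ℂ}
    (hK : MemLp K 2 (μ.prod μ))
    (hKa : Tendsto (fun n : ℕ => eLpNorm
      (fun p => K p - ∑ k ∈ Finset.range n, a k * tensorConj (b k) (b k) p) 2 (μ.prod μ))
      atTop (𝓝 0))
    {T : Lp ℂ 2 μ →L[ℂ] Lp ℂ 2 μ} (hT : ∀ f k, inner ℂ (b k) (T f) = a k * inner ℂ (b k) f)
    (g : Lp ℂ 2 μ) :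
    ∀ᵐ x ∂μ, Integrable (fun y => K (x, y) * g y) μ ∧ T g x = ∫ y, K (x, y) * g y ∂μ := by
  have hint : ∀ᵐ x ∂μ, Integrable (fun y => K (x, y) * g y) μ := by
    filter_upwards [ae_memLp_section hK] with x hx
    exact hx.integrable_mul (Lp.memLp g)
  suffices h : T g =ᵐ[μ] fun x => ∫ y, K (x, y) * g y ∂μ by
    filter_upwards [hint, h] with x h1 h2 using ⟨h1, h2⟩
  set P : ℕ → X × X → ℂ := fun n p =>
    ∑ k ∈ Finset.range n, a k * tensorConj (b k) (b k) p with hP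
  have hPm : ∀ n, AEStronglyMeasurable (P n) (μ.prod μ) := fun n =>
    Finset.aestronglyMeasurable_fun_sum _ fun k _ =>
      (memLp_tensorConj (b k) (b k)).1.const_mul (a k)
  have hbg : ∀ k, Integrable (fun y => (starRingEnd ℂ) (b k y) * g y) μ := fun k =>
    (Lp.memLp (b k)).star.integrable_mul (Lp.memLp g)
  have hPg : ∀ n x, (fun y => P n (x, y) * g y) = fun y => ∑ k ∈ Finset.range n,
      a k * b k x * ((starRingEnd ℂ) (b k y) * g y) := fun n x => by
    ext y
    simp only [hP, Finset.sum_mul, tensorConj]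
    exact Finset.sum_congr rfl fun k _ => by ring
  have hPint : ∀ n x, Integrable (fun y => P n (x, y) * g y) μ := fun n x => by
    rw [hPg]
    exact integrable_finsetSum _ fun k _ => (hbg k).const_mul _
  -- `D n` is the image of `g` under the truncated kernel `P n`, and also a partial sum of the
  -- expansion of `T g`.
  set D : ℕ → Lp ℂ 2 μ := fun n => ∑ k ∈ Finset.range n, (a k * inner ℂ (b k) g) • b k with hD
  have hDP : ∀ n, D n =ᵐ[μ] fun x => ∫ y, P n (x, y) * g y ∂μ := fun n => by
    have h3 : ∀ k, ⇑((a k * inner ℂ (b k) g) • b k) =ᵐ[μ]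
        fun x => ∫ y, a k * b k x * ((starRingEnd ℂ) (b k y) * g y) ∂μ := fun k => by
      filter_upwards [Lp.coeFn_smul (a k * inner ℂ (b k) g) (b k)] with x h4
      rw [h4, Pi.smul_apply, integral_const_mul, L2.inner_def]
      simp only [RCLike.inner_apply, smul_eq_mul, mul_comm (g _)]
      ring
    filter_upwards [Lp.coeFn_finsetSum (Finset.range n)
      (fun k => (a k * inner ℂ (b k) g) • b k), ae_all_iff.2 h3] with x h4 h5
    rw [h4, Finset.sum_apply, hPg, integral_finsetSum _ fun k _ => (hbg k).const_mul _]
    exact Finset.sum_congr rfl fun k _ => h5 k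
  have hDT : Tendsto (fun n => eLpNorm (T g - D n : X → ℂ) 2 μ) atTop (𝓝 0) := by
    have h := (b.hasSum_repr (T g)).tendsto_sum_nat
    simp only [b.repr_apply_apply, hT] at h
    refine ((Lp.tendsto_Lp_iff_tendsto_eLpNorm' _ _).1 h).congr fun n => ?_
    rw [← eLpNorm_neg, neg_sub]
  have hKm : AEStronglyMeasurable (fun x => ∫ y, K (x, y) * g y ∂μ) μ :=
    (hK.1.mul (Lp.memLp g).1.comp_snd).integral_prod_right'
  -- Triangle inequality through `D n`: the first term is the tail of the expansion of `T g`, the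
  -- second the Hilbert-Schmidt bound for the kernel `K - P n`.
  have hbound : ∀ n, eLpNorm (⇑(T g) - fun x => ∫ y, K (x, y) * g y ∂μ) 2 μ ≤
      eLpNorm (T g - D n : X → ℂ) 2 μ +
        eLpNorm (fun p => K p - P n p) 2 (μ.prod μ) * eLpNorm g 2 μ := fun n => by
    have h1 : eLpNorm (⇑(D n) - fun x => ∫ y, K (x, y) * g y ∂μ) 2 μ ≤
        eLpNorm (fun p => K p - P n p) 2 (μ.prod μ) * eLpNorm g 2 μ := by
      refine le_trans (le_of_eq ?_) (eLpNorm_integral_mul_le (hK.1.sub (hPm n)) (Lp.memLp g).1)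
      rw [← eLpNorm_neg]
      refine eLpNorm_congr_ae ?_
      filter_upwards [hDP n, hint] with x h2 h3
      simp only [Pi.neg_apply, Pi.sub_apply, h2, neg_sub, sub_mul]
      exact (integral_sub h3 (hPint n x)).symm
    refine le_trans ?_ (add_le_add le_rfl h1)
    refine le_trans (le_of_eq ?_) (eLpNorm_add_le ((Lp.memLp (T g)).1.sub (Lp.memLp (D n)).1)
      ((Lp.memLp (D n)).1.sub hKm) (by norm_num))
    rw [sub_add_sub_cancel]
  have hlim : Tendsto (fun n => eLpNorm (T g - D n : X → ℂ) 2 μ +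
      eLpNorm (fun p => K p - P n p) 2 (μ.prod μ) * eLpNorm g 2 μ) atTop (𝓝 0) := by
    have := hDT.add (ENNReal.Tendsto.mul_const hKa (Or.inr (Lp.memLp g).2.ne))
    simpa using this
  have h0 := le_antisymm (ge_of_tendsto' hlim hbound) zero_le
  have h1 := (eLpNorm_eq_zero_iff ((Lp.memLp (T g)).1.sub hKm) (by norm_num)).1 h0
  filter_upwards [h1] with x hx
  exact sub_eq_zero.1 hx

end Kernel

/-! ### Convolution as a multiplier, and the theorem. -/

theorem LaplaceEigenbasis.conv_eq {d : ℕ} {M : Type*} [TopologicalSpace M]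
    [ChartedSpace (EuclideanSpace ℝ (Fin d)) M]
    [RiemannianBundle (fun x : M => TangentSpace (𝓡 d) x)] [MeasurableSpace M]
    (B : LaplaceEigenbasis d M) (h : L2 d M) {T : L2 d M →L[ℂ] L2 d M}
    (hT : ∀ f k, inner ℂ (B.φ k) (T f) = B.coeff h k * inner ℂ (B.φ k) f) (f : L2 d M) :
    B.conv h f = T f := by
  refine Eq.trans (tsum_congr fun k => ?_) (B.φ.hasSum_repr (T f)).tsum_eq
  rw [B.φ.repr_apply_apply, hT, mul_comm]
  rfl

end

theorem mainTheorem4 {d : ℕ}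
    {M : Type*} [TopologicalSpace M] [T2Space M] [CompactSpace M] [ConnectedSpace M]
    [MeasurableSpace M] [BorelSpace M]
    [ChartedSpace (EuclideanSpace ℝ (Fin d)) M] [IsManifold (𝓡 d) ∞ M]
    [RiemannianBundle (fun x : M => TangentSpace (𝓡 d) x)]
    [IsContMDiffRiemannianBundle (𝓡 d) ∞ (EuclideanSpace ℝ (Fin d))
      (fun x : M => TangentSpace (𝓡 d) x)]
    {M' : Type*} [TopologicalSpace M'] [T2Space M'] [CompactSpace M'] [ConnectedSpace M']
    [MeasurableSpace M'] [BorelSpace M']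
    [ChartedSpace (EuclideanSpace ℝ (Fin d)) M'] [IsManifold (𝓡 d) ∞ M']
    [RiemannianBundle (fun x : M' => TangentSpace (𝓡 d) x)]
    [IsContMDiffRiemannianBundle (𝓡 d) ∞ (EuclideanSpace ℝ (Fin d))
      (fun x : M' => TangentSpace (𝓡 d) x)]
    (B : LaplaceEigenbasis d M) (h : L2 d M) (hh : B.IsSpectralFilter h) :
    (∀ (ζ : M ≃ₘ^∞⟮𝓡 d, 𝓡 d⟯ M) (hζ : IsRiemannianIsometry ζ) (f : L2 d M),
      B.conv h (deformation ζ hζ f) = deformation ζ hζ (B.conv h f)) ∧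
    (∀ (B' : LaplaceEigenbasis d M') (H : ℝ → ℂ), B.IsSpectralFunction h H →
      ∀ (ζ : M ≃ₘ^∞⟮𝓡 d, 𝓡 d⟯ M') (hζ : IsRiemannianIsometry ζ),
        (∃ K' : M' × M' → ℂ, B'.IsSpectralKernel H K') ∧
        ∀ K' : M' × M' → ℂ, B'.IsSpectralKernel H K' →
          ∃ T' : L2 d M' →L[ℂ] L2 d M', IsIntegralOperator K' T' ∧
            ∀ f : L2 d M, T' (deformation ζ hζ f) = deformation ζ hζ (B.conv h f)) := by
  have ha : Summable fun k => ‖B.coeff h k‖ ^ 2 := (B.φ.hasSum_norm_inner_sq h).summable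
  obtain ⟨T, hT⟩ := B.φ.exists_multiplier ha
  refine ⟨fun ζ hζ f => ?_, fun B' H hH ζ hζ => ?_⟩
  · rw [B.conv_eq h hT, B.conv_eq h hT]
    -- A nonzero matrix entry forces `B.eig l = B.eig k`, and then the filter condition equates the
    -- two coefficients.
    refine multiplier_comp_eq B.φ B.φ (deformation ζ hζ) (fun k l hkl => hh l k ?_) hT hT f
    exact not_not.1 fun hne => hkl (inner_deformation_eq_zero B B hζ hne)
  · have hV : ∀ k l, inner ℂ (B'.φ l) (deformation ζ hζ (B.φ k)) ≠ 0 →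
        H (B'.eig l) = B.coeff h k := fun k l hkl => by
      -- Here `H` links the two spectra: the eigenvalues coincide wherever the entry is nonzero.
      rw [not_not.1 fun hne => hkl (inner_deformation_eq_zero B B' hζ hne), hH]
    have ha' : Summable fun l => ‖H (B'.eig l)‖ ^ 2 :=
      summable_norm_sq_of_intertwined B.φ B'.φ (deformation ζ hζ) (deformation_surjective hζ) hV ha
    refine ⟨exists_kernel B'.φ ha', fun K' hK' => ?_⟩
    obtain ⟨T', hT'⟩ := B'.φ.exists_multiplier ha'
    refine ⟨T', fun g => multiplier_eq_integral B'.φ hK'.1 hK'.2 hT' g, fun f => ?_⟩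
    rw [B.conv_eq h hT]
    exact multiplier_comp_eq B.φ B'.φ (deformation ζ hζ) hV hT hT' f
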